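/- A skew configuration is a finite set of pairwise disjoint, pairwise non-parallel lines in $\mathbb R^3$; an isotopy of skew configurations is a continuous deformation of a skew configuration through skew configurations, parametrised by $[0,1]$, and it induces a bijection from the lines of the initial configuration to the lines of the final one. A spindle with spindle-permutation $\sigma\in\mathrm{Sym}\{1,\dots,n\}$ is a skew configuration $L_1,\dots,L_n$ for which there are an oriented line $A$ (the axis) meeting $L_1,\dots,L_n$ in this order, and an oriented line $B$ (the directrix) crossing $A$ negatively (that is, $\det(u,\,b-a,\,v)<0$ if $A=a+\mathbb Ru$ and $B=b+\mathbb Rv$ with orienting directions $u$, $v$), such that $B$ meets the plane $\Pi_i$ spanned by $A$ and $L_i$ in a point $P_i$ for every $i$, and the order of $P_1,\dots,P_n$ along $B$ is given by $\sigma$: $P_i$ precedes $P_j$ if and only if $\sigma(i)<\sigma(j)$. The line $L_i$ is called the line $(i,\sigma(i))$ of $\sigma$. A spindle-configuration associated to $\sigma$ is a skew configuration together with an isotopy from a spindle with spindle-permutation $\sigma$ to it; its lines are thereby identified with the lines $(i,\sigma(i))$ of $\sigma$. A spindle move replaces $\sigma$ by a permutation $\mu$ and induces a bijection from the lines of $\sigma$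 to the lines of $\mu$, as follows. 1. Circular move: $\mu(i)=s+\sigma(i+t)$ for all $i$, where $s,t$ are integers and all sums are modulo $n$; the line $(i+t,\sigma(i+t))$ is sent to $(i,\mu(i))$. 2. Vertical reflection: for some $k\le n$ with $\sigma(\{1,\dots,k\})=\{1,\dots,k\}$, $\mu(i)=k+1-\sigma(k+1-i)$ for $i\le k$ and $\mu(i)=\sigma(i)$ for $i>k$; the line $(i,\sigma(i))$ is sent to $(k+1-i,\,k+1-\sigma(i))$ for $i\le k$, and to $(i,\sigma(i))$ for $i>k$. 3. Horizontal reflection: for some $k\le n$ with $\sigma(\{1,\dots,k\})=\{1,\dots,k\}$, $\mu(i)=\sigma^{-1}(i)$ for $i\le k$ and $\mu(i)=\sigma(i)$ for $i>k$; the line $(i,\sigma(i))$ is sent to $(\sigma(i),i)$ for $i\le k$, and to $(i,\sigma(i))$ for $i>k$. **Theorem.** Let $\sigma,\sigma'$ be permutations of $\{1,\dots,n\}$, let $C$ and $C'$ be spindle-configurations associated to $\sigma$ and $\sigma'$, and let $\iota$ be an isotopy of skew configurations from $C$ to $C'$. Then there is a finite sequence of spindle moves leading from $\sigma$ to $\sigma'$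 such that the composition of the bijections induced by the moves is the bijection from the lines of $\sigma$ to the lines of $\sigma'$ induced by $\iota$. -/

import Mathlib

/-- Affine three-space. -/
abbrev R3 : Type := Fin 3 → ℝ

/-- The set-theoretic line `{p + s • v | s ∈ ℝ}` (an actual line when `v ≠ 0`). -/
def lineThrough (p v : R3) : AffineSubspace ℝ R3 :=
  AffineSubspace.mk' p (Submodule.span ℝ {v})

/-- A labelled configuration of `n` skew lines: lines that are pairwise disjoint and pairwise
non-parallel. -/
structure IsSkewConfiguration {n : ℕ} (C : Fin n → AffineSubspace ℝ R3) : Prop where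
  isLine : ∀ i, ∃ p v : R3, v ≠ 0 ∧ C i = lineThrough p v
  disjoint : ∀ i j, i ≠ j → Disjoint (C i : Set R3) (C j : Set R3)
  not_parallel : ∀ i j, i ≠ j → ¬ (C i).Parallel (C j)

/-- An isotopy of skew configurations: a path, parametrised by `[0,1]`, of skew configurations
along which every line moves continuously. A path of lines in space is continuous exactly when it
can be described by a base point and a non-zero direction vector, both depending continuously on
the time (over an interval such a description can always be chosen globally). -/
structure SkewIsotopy (n : ℕ) where
  lines : unitInterval → Fin n → AffineSubspace ℝ R3
  skew : ∀ t, IsSkewConfiguration (lines t)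
  continuous : ∀ i, ∃ p v : unitInterval → R3, Continuous p ∧ Continuous v ∧
    ∀ t, v t ≠ 0 ∧ lines t i = lineThrough (p t) (v t)

/-- The determinant whose sign is the linking number `lk(A, B)` of two skew oriented lines, `A`
going through `a` in direction `u`, and `B` going through `b` in direction `v`. -/
def crossingDet (a u b v : R3) : ℝ :=
  Matrix.det (Matrix.of ![u, b - a, v])

/-- `C` is a spindle with spindle-permutation `σ`, its lines being labelled in the order in which
they meet the axis. The axis `A` goes through `a` in direction `u`, the directrix `B` goes through
`b` in direction `v` and crosses `A` negatively. The line `C i` meets `A` at the point with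
parameter `s i`, and the plane spanned by `C i` and `A` meets `B` at the point with
parameter `τ i`. The permutation `σ` records the order of the latter points along `B`. -/
def IsSpindle {n : ℕ} (σ : Equiv.Perm (Fin n)) (C : Fin n → AffineSubspace ℝ R3) : Prop :=
  IsSkewConfiguration C ∧
  ∃ (a u b v : R3) (s τ : Fin n → ℝ),
    crossingDet a u b v < 0 ∧
    (∀ i, a + s i • u ∈ C i) ∧
    (∀ i, b + τ i • v ∈ C i ⊔ lineThrough a u) ∧
    (∀ i j, s i < s j ↔ i < j) ∧
    (∀ i j, τ i < τ j ↔ σ i < σ j)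

/-- `C` is a spindle-configuration associated to the spindle-permutation `σ`: it is isotopic to a
spindle with permutation `σ`, the line `C i` corresponding to the line `(i, σ i)` of the spindle. -/
def IsSpindleConfiguration {n : ℕ} (σ : Equiv.Perm (Fin n))
    (C : Fin n → AffineSubspace ℝ R3) : Prop :=
  ∃ κ : SkewIsotopy n, IsSpindle σ (κ.lines 0) ∧ κ.lines 1 = C

/-- `SpindleMove σ μ π`: the permutation `μ` of `{0, …, n-1}` is obtained from `σ` by one spindle
move, and this move carries the line `(i, σ i)` of `σ` to the line `(π i, μ (π i))` of `μ`. -/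
inductive SpindleMove {n : ℕ} : Equiv.Perm (Fin n) → Equiv.Perm (Fin n) →
    Equiv.Perm (Fin n) → Prop
  /-- Circular move: `μ i = s + σ (i + t)`, all sums modulo `n`. -/
  | circular (s t : Fin n) (σ μ π : Equiv.Perm (Fin n))
      (hμ : ∀ i, μ i = s + σ (i + t))
      (hπ : ∀ i, π (i + t) = i) :
      SpindleMove σ μ π
  /-- Vertical reflection of the block formed by the first `k` indices: inside the block,
  `μ i = k - 1 - σ (k - 1 - i)`. -/
  | vertical (k : ℕ) (hk : k ≤ n) (σ μ π : Equiv.Perm (Fin n))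
      (hblock : ∀ i : Fin n, (i : ℕ) < k → (σ i : ℕ) < k)
      (hμ_block : ∀ i j : Fin n, (i : ℕ) + j + 1 = k → (μ i : ℕ) + σ j + 1 = k)
      (hμ_rest : ∀ i : Fin n, k ≤ (i : ℕ) → μ i = σ i)
      (hπ_block : ∀ i j : Fin n, (i : ℕ) + j + 1 = k → π i = j)
      (hπ_rest : ∀ i : Fin n, k ≤ (i : ℕ) → π i = i) :
      SpindleMove σ μ π
  /-- Horizontal reflection of the block formed by the first `k` indices: inside the block,
  `μ i = σ⁻¹ i`, so the line `(i, σ i)` becomes the line `(σ i, i)`. -/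
  | horizontal (k : ℕ) (hk : k ≤ n) (σ μ π : Equiv.Perm (Fin n))
      (hblock : ∀ i : Fin n, (i : ℕ) < k → (σ i : ℕ) < k)
      (hμ_block : ∀ i : Fin n, (i : ℕ) < k → μ i = σ.symm i)
      (hμ_rest : ∀ i : Fin n, k ≤ (i : ℕ) → μ i = σ i)
      (hπ_block : ∀ i : Fin n, (i : ℕ) < k → π i = σ i)
      (hπ_rest : ∀ i : Fin n, k ≤ (i : ℕ) → π i = i) :
      SpindleMove σ μ π

/-- `SpindleMoves σ σ' π`: a finite sequence of spindle moves leads from `σ` to `σ'`, and the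
composed bijection between their lines sends `(i, σ i)` to `(π i, σ' (π i))`. -/
inductive SpindleMoves {n : ℕ} : Equiv.Perm (Fin n) → Equiv.Perm (Fin n) →
    Equiv.Perm (Fin n) → Prop
  | refl (σ : Equiv.Perm (Fin n)) : SpindleMoves σ σ (Equiv.refl (Fin n))
  | tail {σ μ ν π ρ : Equiv.Perm (Fin n)} (h : SpindleMoves σ μ π) (hm : SpindleMove μ ν ρ) :
      SpindleMoves σ ν (π.trans ρ)

/-! The invariant is the sign of the product of the linking numbers of three lines: every
orientation enters twice, so none has to be chosen, and the product cannot vanish along an isotopy.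
In a spindle the linking number of two lines says whether axis and directrix order them alike. Hence
the isotopy forces `σ` and `σ'`, compared through `π`, to have the same parity of inversions on
every triple, and it remains to see that these parities determine a permutation up to spindle moves
(`PosPair.reach_of_tripleEven`).

Lines are treated as fixed labels with two linear orders, so that the bijection of lines is carried
along. Circular moves make one label first in both orders; the parities of the triples containing it
then tell which pairs are inversions (`PosPair.exists_reach_zero`). Two pairs of orders with the
same inversion graph are joined through a third one, which orders the inversions as the first and
the remaining pairs as the second (`PosPair.reach_of_concordant`).

Each half of this passage changes only one kind of pair. On a block, an interval of both orders, the
moves can exchange the two orders; this turns around the inversions, and together with a reversal of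
both orders it turns around the other pairs instead. That these operations suffice is
`PosPair.canFix`: colouring pairs as inversions, agreeing and disagreeing non-inversions gives no
rainbow triangle, so by Gallai (`exists_not_monoConnected`) some colour is disconnected; its
components are smaller blocks, and induction applies. -/

theorem SpindleMoves.trans {n : ℕ} {σ μ ν π ρ : Equiv.Perm (Fin n)} (h : SpindleMoves σ μ π)
    (h' : SpindleMoves μ ν ρ) : SpindleMoves σ ν (π.trans ρ) := by
  induction h' with
  | refl => simpa using h
  | tail _ hm ih => rw [← Equiv.trans_assoc]; exact .tail ih hm

/-- The positions of labelled lines in two linear orders: along the axis and the directrix. -/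
abbrev PosPair (n : ℕ) : Type := Equiv.Perm (Fin n) × Equiv.Perm (Fin n)

/-! ### Spindle moves as operations on blocks of two linear orders -/

namespace PosPair

variable {n : ℕ}

/-- Spindle moves lead from one pair of orders to another, respecting the labels. -/
def Reach (s t : PosPair n) : Prop :=
  SpindleMoves (s.1.symm.trans s.2) (t.1.symm.trans t.2) (s.1.symm.trans t.1)

theorem Reach.refl (s : PosPair n) : Reach s s := by
  simpa [Reach] using SpindleMoves.refl (s.1.symm.trans s.2)

theorem Reach.trans {s t u : PosPair n} (h : Reach s t) (h' : Reach t u) : Reach s u := by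
  have := SpindleMoves.trans h h'
  simpa [Reach, ← Equiv.trans_assoc, Equiv.trans_assoc s.1.symm t.1] using this

theorem Reach.of_move {s t : PosPair n}
    (h : SpindleMove (s.1.symm.trans s.2) (t.1.symm.trans t.2) (s.1.symm.trans t.1)) :
    Reach s t := by
  simpa [Reach] using (SpindleMoves.refl (s.1.symm.trans s.2)).tail h

/-- A circular move subtracts its `t` from the axis positions and adds its `s` to the directrix
positions; hence the opposite forms of the two hypotheses. -/
theorem Reach.rotate {s t : PosPair n} (a b : Fin n) (h₁ : ∀ x, s.1 x = t.1 x + a)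
    (h₂ : ∀ x, t.2 x = b + s.2 x) : Reach s t := by
  refine .of_move (.circular b a _ _ _ (fun i => ?_) (fun i => ?_))
  · have : s.1.symm (i + a) = t.1.symm i := by
      rw [Equiv.symm_apply_eq, h₁, Equiv.apply_symm_apply]
    simp [this, h₂]
  · have : s.1.symm (i + a) = t.1.symm i := by
      rw [Equiv.symm_apply_eq, h₁, Equiv.apply_symm_apply]
    simp [this]

/-- Swapping the two orders on a common initial segment. -/
theorem exists_reach_swap_initial (s : PosPair n) (k : ℕ) (hk : k ≤ n)
    (h : ∀ x, (s.1 x : ℕ) < k ↔ (s.2 x : ℕ) < k) :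
    ∃ t, Reach s t ∧ ∀ x, ((s.1 x : ℕ) < k → t.1 x = s.2 x ∧ t.2 x = s.1 x) ∧
      (¬ (s.1 x : ℕ) < k → t.1 x = s.1 x ∧ t.2 x = s.2 x) := by
  have key : ∀ f g : Equiv.Perm (Fin n), (∀ x, (f x : ℕ) < k ↔ (g x : ℕ) < k) →
      Function.Bijective fun x => if (f x : ℕ) < k then g x else f x := by
    intro f g hfg
    rw [← Finite.injective_iff_bijective]
    intro x y hxy
    have h1 := hfg x
    have h2 := hfg y
    dsimp only at hxy
    split_ifs at hxy with p q q
    · exact g.injective hxy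
    · rw [hxy] at h1; tauto
    · rw [← hxy] at h2; tauto
    · exact f.injective hxy
  obtain ⟨α, hα⟩ : ∃ α : Equiv.Perm (Fin n), ∀ x, α x = if (s.1 x : ℕ) < k then s.2 x else s.1 x :=
    ⟨Equiv.ofBijective _ (key s.1 s.2 h), fun x => rfl⟩
  obtain ⟨β, hβ⟩ : ∃ β : Equiv.Perm (Fin n), ∀ x, β x = if (s.1 x : ℕ) < k then s.1 x else s.2 x :=
    ⟨Equiv.ofBijective _ (key s.2 s.1 fun x => (h x).symm), fun x => by simp [h x]⟩
  refine ⟨(α, β), .of_move (.horizontal k hk _ _ _ ?_ ?_ ?_ ?_ ?_), fun x => ?_⟩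
  · intro i hi
    simpa [h] using (h (s.1.symm i)).1 (by simpa using hi)
  · intro i hi
    obtain ⟨x, rfl⟩ := s.2.surjective i
    have hx := (h x).2 hi
    have : α.symm (s.2 x) = x := by rw [Equiv.symm_apply_eq, hα, if_pos hx]
    simp [this, hβ, hx]
  · intro i hi
    obtain ⟨x, rfl⟩ := s.1.surjective i
    have : α.symm (s.1 x) = x := by rw [Equiv.symm_apply_eq, hα, if_neg (by omega)]
    simp [this, hβ, hi]
  · intro i hi
    obtain ⟨x, rfl⟩ := s.1.surjective i
    simp [hα, hi]
  · intro i hi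
    obtain ⟨x, rfl⟩ := s.1.surjective i
    simp [hα, hi]
  · constructor <;> intro hx <;> simp [hα, hβ, hx]

/-- Reversing both orders on a common initial segment. -/
theorem exists_reach_reverse_initial (s : PosPair n) (k : ℕ) (hk : k ≤ n)
    (h : ∀ x, (s.1 x : ℕ) < k ↔ (s.2 x : ℕ) < k) :
    ∃ t, Reach s t ∧ ∀ x, ((s.1 x : ℕ) < k →
        (t.1 x : ℕ) + s.1 x + 1 = k ∧ (t.2 x : ℕ) + s.2 x + 1 = k) ∧
      (¬ (s.1 x : ℕ) < k → t.1 x = s.1 x ∧ t.2 x = s.2 x) := by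
  have key : ∀ f : Equiv.Perm (Fin n), ∃ g : Equiv.Perm (Fin n), ∀ x,
      ((f x : ℕ) < k → (g x : ℕ) + f x + 1 = k) ∧ (¬ (f x : ℕ) < k → g x = f x) := by
    intro f
    have hinj : Function.Injective fun x : Fin n =>
        if hx : (f x : ℕ) < k then (⟨k - 1 - f x, by omega⟩ : Fin n) else f x := by
      intro x y hxy
      apply f.injective
      dsimp only at hxy
      split_ifs at hxy with p q q <;> simp only [Fin.ext_iff] at hxy ⊢ <;> omega
    refine ⟨Equiv.ofBijective _ (Finite.injective_iff_bijective.1 hinj), fun x => ⟨?_, ?_⟩⟩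
    · intro hx
      simp only [Equiv.ofBijective_apply, hx, dif_pos]
      omega
    · intro hx
      simp [hx]
  obtain ⟨α, hα⟩ := key s.1
  obtain ⟨β, hβ⟩ := key s.2
  refine ⟨(α, β), .of_move (.vertical k hk _ _ _ ?_ ?_ ?_ ?_ ?_), fun x => ⟨?_, ?_⟩⟩
  · intro i hi
    simpa [h] using (h (s.1.symm i)).1 (by simpa using hi)
  · intro i j hij
    obtain ⟨x, rfl⟩ := s.1.surjective j
    have hx := (hα x).1 (by omega)
    have : α.symm i = x := by
      rw [Equiv.symm_apply_eq, Fin.ext_iff]; omega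
    simpa [this] using (hβ x).1 ((h x).1 (by omega))
  · intro i hi
    obtain ⟨x, rfl⟩ := s.1.surjective i
    have : α.symm (s.1 x) = x := by rw [Equiv.symm_apply_eq, (hα x).2 (by omega)]
    simpa [this] using (hβ x).2 (by rw [← h x]; omega)
  · intro i j hij
    obtain ⟨x, rfl⟩ := s.1.surjective i
    have hx := (hα x).1 (by omega)
    simp only [Equiv.trans_apply, Equiv.symm_apply_apply, Fin.ext_iff]
    omega
  · intro i hi
    obtain ⟨x, rfl⟩ := s.1.surjective i
    simpa using (hα x).2 (by omega)
  · exact fun hx => ⟨(hα x).1 hx, (hβ x).1 ((h x).1 hx)⟩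
  · exact fun hx => ⟨(hα x).2 hx, (hβ x).2 (by rwa [← h x])⟩

/-- A set of labels that is an interval in both orders. -/
def IsBlock (s : PosPair n) (M : Finset (Fin n)) : Prop :=
  ∀ x, x ∉ M → ∀ y ∈ M, ∀ z ∈ M, (s.1 x < s.1 y ↔ s.1 x < s.1 z) ∧ (s.2 x < s.2 y ↔ s.2 x < s.2 z)

theorem exists_interval (f : Equiv.Perm (Fin n)) {M : Finset (Fin n)} (hM : M.Nonempty)
    (h : ∀ x, x ∉ M → ∀ y ∈ M, ∀ z ∈ M, (f x < f y ↔ f x < f z)) :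
    ∃ a : Fin n, ∀ x, x ∈ M ↔ a ≤ f x ∧ (f x : ℕ) < a + M.card := by
  obtain ⟨p, hp, hmin⟩ := M.exists_min_image f hM
  obtain ⟨q, hq, hmax⟩ := M.exists_max_image f hM
  have hmem : ∀ x, x ∈ M ↔ f p ≤ f x ∧ f x ≤ f q := by
    refine fun x => ⟨fun hx => ⟨hmin x hx, hmax x hx⟩, fun hx => ?_⟩
    by_contra hxM
    have h1 : f x ≠ f p := fun e => hxM (f.injective e ▸ hp)
    have h2 : f x ≠ f q := fun e => hxM (f.injective e ▸ hq)
    have := (h x hxM p hp q hq).2 (lt_of_le_of_ne hx.2 h2)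
    exact absurd hx.1 (not_le.2 this)
  have himg : M.map f.toEmbedding = Finset.Icc (f p) (f q) := by
    ext i
    obtain ⟨x, rfl⟩ := f.surjective i
    simp [hmem]
  have hcard : M.card = (f q : ℕ) + 1 - f p := by
    rw [← Fin.card_Icc, ← himg, Finset.card_map]
  have hpq := hmin q hq
  refine ⟨f p, fun x => ?_⟩
  rw [hmem x, hcard]
  simp only [Fin.le_def] at *
  omega

/-- Every block can be brought to the initial position by rotations. -/
theorem exists_rotation (s : PosPair n) {M : Finset (Fin n)} (hM : IsBlock s M)
    (hne : M.Nonempty) :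
    ∃ (a b : Fin n) (s' : PosPair n), Reach s s' ∧
      (∀ x, x ∈ M ↔ (s'.1 x : ℕ) < M.card) ∧ (∀ x, x ∈ M ↔ (s'.2 x : ℕ) < M.card) ∧
      (a : ℕ) + M.card ≤ n ∧ (b : ℕ) + M.card ≤ n ∧
      (∀ x, s.1 x = s'.1 x + a) ∧ (∀ x, s.2 x = s'.2 x + b) := by
  have hn : NeZero n := ⟨by rintro rfl; exact hne.choose.elim0⟩
  have key : ∀ f : Equiv.Perm (Fin n),
      (∀ x, x ∉ M → ∀ y ∈ M, ∀ z ∈ M, (f x < f y ↔ f x < f z)) →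
      ∃ (a : Fin n) (g : Equiv.Perm (Fin n)), (∀ x, x ∈ M ↔ (g x : ℕ) < M.card) ∧
        (a : ℕ) + M.card ≤ n ∧ ∀ x, f x = g x + a := by
    intro f hf
    obtain ⟨a, ha⟩ := exists_interval f hne hf
    have hle : (a : ℕ) + M.card ≤ n := by
      by_contra hlt
      have hlt' : n < a + M.card := by omega
      have himg : M.map f.toEmbedding = Finset.Ici a := by
        ext i
        obtain ⟨x, rfl⟩ := f.surjective i
        simp only [Finset.mem_map_equiv, Equiv.symm_apply_apply, ha, Finset.mem_Ici]
        omega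
      have : M.card = n - a := by rw [← Fin.card_Ici, ← himg, Finset.card_map]
      omega
    refine ⟨a, f.trans (Equiv.subRight a), fun x => ?_, hle, fun x => by simp⟩
    rw [ha x]
    simp only [Equiv.trans_apply, Equiv.subRight_apply]
    have := (f x).isLt
    rcases le_or_gt a (f x) with h | h
    · rw [Fin.sub_val_of_le h]
      rw [Fin.le_def] at *
      omega
    · rw [Fin.coe_sub_iff_lt.2 h]
      rw [Fin.le_def] at *
      rw [Fin.lt_def] at *
      omega
  obtain ⟨a, g, h1, h2, h3⟩ := key s.1 fun x hx y hy z hz => (hM x hx y hy z hz).1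
  obtain ⟨b, g', h1', h2', h3'⟩ := key s.2 fun x hx y hy z hz => (hM x hx y hy z hz).2
  refine ⟨a, b, (g, g'), .rotate a (-b) h3 (fun x => ?_), h1, h1', h2, h2', h3, h3'⟩
  simp [h3']

/-- `t` results from `s` by swapping the two orders on `M`. -/
def IsSwap (M : Finset (Fin n)) (s t : PosPair n) : Prop :=
  ∀ x y, (x ∈ M ∧ y ∈ M → (t.1 x < t.1 y ↔ s.2 x < s.2 y) ∧ (t.2 x < t.2 y ↔ s.1 x < s.1 y)) ∧
    (¬ (x ∈ M ∧ y ∈ M) → (t.1 x < t.1 y ↔ s.1 x < s.1 y) ∧ (t.2 x < t.2 y ↔ s.2 x < s.2 y))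

/-- `t` results from `s` by swapping the two orders on `M` and reversing both. -/
def IsSwapReverse (M : Finset (Fin n)) (s t : PosPair n) : Prop :=
  ∀ x y, (x ∈ M ∧ y ∈ M → (t.1 x < t.1 y ↔ s.2 y < s.2 x) ∧ (t.2 x < t.2 y ↔ s.1 y < s.1 x)) ∧
    (¬ (x ∈ M ∧ y ∈ M) → (t.1 x < t.1 y ↔ s.1 x < s.1 y) ∧ (t.2 x < t.2 y ↔ s.2 x < s.2 y))


theorem val_add_cases {p q a : Fin n} (h : p = q + a) :
    (p : ℕ) = q + a ∨ (p : ℕ) + n = q + a := by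
  have := q.isLt
  have := a.isLt
  rw [h, Fin.val_add_eq_ite]
  split_ifs <;> omega

theorem exists_rotation_back (t' : PosPair n) (a b : Fin n) :
    ∃ t, Reach t' t ∧ (∀ x, t.1 x = t'.1 x + a) ∧ (∀ x, t.2 x = t'.2 x + b) := by
  have hn : NeZero n := ⟨by rintro rfl; exact a.elim0⟩
  exact ⟨(t'.1.trans (Equiv.addRight a), t'.2.trans (Equiv.addRight b)),
    .rotate (-a) b (fun x => by simp) (fun x => by simp [add_comm]), fun x => rfl, fun x => rfl⟩

theorem exists_reach_isSwap (s : PosPair n) {M : Finset (Fin n)} (hM : IsBlock s M) :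
    ∃ t, Reach s t ∧ IsSwap M s t := by
  rcases M.eq_empty_or_nonempty with rfl | hne
  · exact ⟨s, .refl s, fun x y => by simp⟩
  obtain ⟨a, b, s', hs', h1, h2, ha, hb, hα, hβ⟩ := exists_rotation s hM hne
  obtain ⟨t', ht', hst⟩ := exists_reach_swap_initial s' M.card (by omega)
    fun x => (h1 x).symm.trans (h2 x)
  obtain ⟨t, ht, hα', hβ'⟩ := exists_rotation_back t' a b
  refine ⟨t, hs'.trans (ht'.trans ht), ?_⟩
  have H : ∀ x, (x ∈ M ∧ (s'.1 x : ℕ) < M.card ∧ (s'.2 x : ℕ) < M.card ∧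
      (t'.1 x : ℕ) = s'.2 x ∧ (t'.2 x : ℕ) = s'.1 x) ∨
      (x ∉ M ∧ M.card ≤ (s'.1 x : ℕ) ∧ M.card ≤ (s'.2 x : ℕ) ∧
      (t'.1 x : ℕ) = s'.1 x ∧ (t'.2 x : ℕ) = s'.2 x) := by
    intro x
    by_cases hx : x ∈ M
    · have := (hst x).1 ((h1 x).1 hx)
      exact .inl ⟨hx, (h1 x).1 hx, (h2 x).1 hx, by rw [this.1], by rw [this.2]⟩
    · have hx1 := mt (h1 x).2 hx
      have := (hst x).2 hx1
      exact .inr ⟨hx, not_lt.1 hx1, not_lt.1 (mt (h2 x).2 hx), by rw [this.1], by rw [this.2]⟩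
  -- The block still occupies the first `M.card` places, and `a + M.card ≤ n`, `b + M.card ≤ n`, so
  -- rotating back does not tear it; labels outside it return to their old places.
  intro x y
  have := val_add_cases (hα x)
  have := val_add_cases (hα y)
  have := val_add_cases (hβ x)
  have := val_add_cases (hβ y)
  have := val_add_cases (hα' x)
  have := val_add_cases (hα' y)
  have := val_add_cases (hβ' x)
  have := val_add_cases (hβ' y)
  simp only [Fin.lt_def]
  rcases H x with ⟨hx, _⟩ | ⟨hx, _⟩ <;> rcases H y with ⟨hy, _⟩ | ⟨hy, _⟩ <;>
    simp only [hx, hy, true_and, and_true, and_self, not_true_eq_false, not_false_eq_true,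
      forall_true_left, and_false, IsEmpty.forall_iff] <;>
    constructor <;> omega

theorem exists_reach_isSwapReverse (s : PosPair n) {M : Finset (Fin n)} (hM : IsBlock s M) :
    ∃ t, Reach s t ∧ IsSwapReverse M s t := by
  rcases M.eq_empty_or_nonempty with rfl | hne
  · exact ⟨s, .refl s, fun x y => by simp⟩
  obtain ⟨a, b, s', hs', h1, h2, ha, hb, hα, hβ⟩ := exists_rotation s hM hne
  obtain ⟨u, hu, hsu⟩ := exists_reach_swap_initial s' M.card (by omega)
    fun x => (h1 x).symm.trans (h2 x)
  have H : ∀ x, (x ∈ M ∧ (s'.1 x : ℕ) < M.card ∧ (s'.2 x : ℕ) < M.card ∧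
      (u.1 x : ℕ) = s'.2 x ∧ (u.2 x : ℕ) = s'.1 x) ∨
      (x ∉ M ∧ M.card ≤ (s'.1 x : ℕ) ∧ M.card ≤ (s'.2 x : ℕ) ∧
      (u.1 x : ℕ) = s'.1 x ∧ (u.2 x : ℕ) = s'.2 x) := by
    intro x
    by_cases hx : x ∈ M
    · have := (hsu x).1 ((h1 x).1 hx)
      exact .inl ⟨hx, (h1 x).1 hx, (h2 x).1 hx, by rw [this.1], by rw [this.2]⟩
    · have hx1 := mt (h1 x).2 hx
      have := (hsu x).2 hx1
      exact .inr ⟨hx, not_lt.1 hx1, not_lt.1 (mt (h2 x).2 hx), by rw [this.1], by rw [this.2]⟩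
  obtain ⟨t', ht', hut⟩ := exists_reach_reverse_initial u M.card (by omega)
    fun x => by have := H x; omega
  obtain ⟨t, ht, hα', hβ'⟩ := exists_rotation_back t' a b
  refine ⟨t, hs'.trans (hu.trans (ht'.trans ht)), ?_⟩
  have H' : ∀ x, (x ∈ M ∧ (s'.1 x : ℕ) < M.card ∧ (s'.2 x : ℕ) < M.card ∧
      (t'.1 x : ℕ) + s'.2 x + 1 = M.card ∧ (t'.2 x : ℕ) + s'.1 x + 1 = M.card) ∨
      (x ∉ M ∧ M.card ≤ (s'.1 x : ℕ) ∧ M.card ≤ (s'.2 x : ℕ) ∧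
      (t'.1 x : ℕ) = s'.1 x ∧ (t'.2 x : ℕ) = s'.2 x) := by
    intro x
    rcases H x with ⟨hx, h3, h4, h5, h6⟩ | ⟨hx, h3, h4, h5, h6⟩
    · have := (hut x).1 (by omega)
      exact .inl ⟨hx, h3, h4, by omega, by omega⟩
    · have := (hut x).2 (by omega)
      exact .inr ⟨hx, h3, h4, by rw [this.1, h5], by rw [this.2, h6]⟩
  intro x y
  have := val_add_cases (hα x)
  have := val_add_cases (hα y)
  have := val_add_cases (hβ x)
  have := val_add_cases (hβ y)
  have := val_add_cases (hα' x)
  have := val_add_cases (hα' y)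
  have := val_add_cases (hβ' x)
  have := val_add_cases (hβ' y)
  simp only [Fin.lt_def]
  rcases H' x with ⟨hx, _⟩ | ⟨hx, _⟩ <;> rcases H' y with ⟨hy, _⟩ | ⟨hy, _⟩ <;>
    simp only [hx, hy, true_and, and_true, and_self, not_true_eq_false, not_false_eq_true,
      forall_true_left, and_false, IsEmpty.forall_iff] <;>
    constructor <;> omega

end PosPair

/-! ### Edge colourings without rainbow triangles -/

section Gallai

variable {V κ : Type*}

/-- `x` and `y` are joined inside `M` by a path of edges of colour `c`. -/
def MonoConnected (col : V → V → κ) (c : κ) (M : Finset V) : V → V → Prop :=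
  Relation.ReflTransGen fun x y => x ∈ M ∧ y ∈ M ∧ x ≠ y ∧ col x y = c

variable {col : V → V → κ} {c : κ} {M : Finset V}

theorem MonoConnected.symm (hcol : ∀ x y, col x y = col y x) {x y : V}
    (h : MonoConnected col c M x y) : MonoConnected col c M y x := by
  induction h with
  | refl => exact .refl
  | tail _ h ih => exact .head ⟨h.2.1, h.1, h.2.2.1.symm, by rw [hcol, h.2.2.2]⟩ ih

/-- Vertices outside of a monochromatic component see it in only one colour. -/
theorem MonoConnected.col_eq (hcol : ∀ x y, col x y = col y x)
    (hrain : ∀ x y z, x ≠ y → y ≠ z → x ≠ z →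
      col x y = col y z ∨ col x y = col x z ∨ col y z = col x z)
    {x y z : V} (hz : z ∈ M) (h : MonoConnected col c M x y)
    (hxz : ¬ MonoConnected col c M x z) : col z x = col z y := by
  induction h with
  | refl => rfl
  | @tail y w hy hyw ih =>
    rw [ih]
    have hyz : y ≠ z := fun e => hxz (e ▸ hy)
    have hwz : w ≠ z := fun e => hxz (e ▸ hy.tail hyw)
    have h1 : col z y ≠ c := fun e => hxz (hy.tail ⟨hyw.1, hz, hyz, by rw [hcol, e]⟩)
    have h2 : col z w ≠ c :=
      fun e => hxz ((hy.tail hyw).tail ⟨hyw.2.1, hz, hwz, by rw [hcol, e]⟩)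
    have := hrain z y w hyz.symm hyw.2.2.1 hwz.symm
    rw [hyw.2.2.2] at this
    tauto

/-- Gallai: without rainbow triangles, some colour is disconnected. -/
theorem exists_not_monoConnected [DecidableEq V] (hcol : ∀ x y, col x y = col y x)
    (hrain : ∀ x y z, x ≠ y → y ≠ z → x ≠ z →
      col x y = col y z ∨ col x y = col x z ∨ col y z = col x z)
    (hκ : ∀ c : κ, ∃ a b, a ≠ b ∧ a ≠ c ∧ b ≠ c) (M : Finset V) (hM : 1 < M.card) :
    ∃ c, ∃ x ∈ M, ∃ y ∈ M, ¬ MonoConnected col c M x y := by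
  induction M using Finset.induction_on with
  | empty => simp at hM
  | insert v M hv ih =>
    by_contra! hcon
    -- Every colour joins `v` to `M`, so some edge at `v` has that colour.
    have isolated : ∀ a, ∃ x ∈ M, col v x = a := by
      intro a
      obtain ⟨y, hy⟩ : M.Nonempty := by
        rw [← Finset.card_pos]; rw [Finset.card_insert_of_notMem hv] at hM; omega
      have := hcon a v (by simp) y (by simp [hy])
      rcases Relation.ReflTransGen.cases_head this with rfl | ⟨x, hx, -⟩
      · exact absurd hy hv
      · exact ⟨x, (Finset.mem_insert.1 hx.2.1).resolve_left hx.2.2.1.symm, hx.2.2.2⟩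
    have hcard : 1 < M.card := by
      by_contra hle
      have : M.card ≤ 1 := by omega
      rw [Finset.card_le_one] at this
      obtain ⟨a, b, hab, -, -⟩ := hκ (col v v)
      obtain ⟨x, hx, rfl⟩ := isolated a
      obtain ⟨y, hy, rfl⟩ := isolated b
      exact hab (by rw [this x hx y hy])
    obtain ⟨c, p, hp, q, hq, hpq⟩ := ih hcard
    -- A path from `x` to `v` stays in `M` until it enters `v`, so each `c`-component of `M` has a
    -- `c`-edge to `v`.
    have step : ∀ x ∈ M, ∃ w, MonoConnected col c M x w ∧ w ∈ M ∧ col v w = c := by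
      intro x hx
      have main : ∀ z, MonoConnected col c (insert v M) x z → (z ∈ M ∧ MonoConnected col c M x z) ∨
          ∃ w, MonoConnected col c M x w ∧ w ∈ M ∧ col v w = c := by
        intro z hz
        induction hz with
        | refl => exact .inl ⟨hx, .refl⟩
        | @tail y z _ hyz ih =>
          rcases ih with ⟨hy, hxy⟩ | h
          · rcases Finset.mem_insert.1 hyz.2.1 with rfl | hz
            · exact .inr ⟨y, hxy, hy, by rw [hcol, hyz.2.2.2]⟩
            · exact .inl ⟨hz, hxy.tail ⟨hy, hz, hyz.2.2⟩⟩
          · exact .inr h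
      rcases main v (hcon c x (by simp [hx]) v (by simp)) with h | h
      · exact absurd h.1 hv
      · exact h
    have color : ∀ x ∈ M, col v x ≠ c → ∀ y ∈ M, ¬ MonoConnected col c M y x →
        col x y = col v x := by
      intro x hx hvx y hy hyx
      obtain ⟨w, hyw, hw, hvw⟩ := step y hy
      have h1 : col x y = col x w := hyw.col_eq hcol hrain hx hyx
      have hxw : x ≠ w := fun e => hyx (e ▸ hyw)
      have h2 : col x w ≠ c := fun e => hyx (hyw.tail ⟨hw, hx, hxw.symm, by rw [hcol, e]⟩)
      -- In this triangle only the side from `v` to `w` has colour `c`, so the other two sides share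
      -- their colour.
      have := hrain v x w (fun e => hv (e ▸ hx)) hxw (fun e => hv (e ▸ hw))
      rw [hvw] at this
      rw [h1]
      tauto
    obtain ⟨a, b, hab, hac, hbc⟩ := hκ c
    obtain ⟨x, hx, rfl⟩ := isolated a
    obtain ⟨y, hy, rfl⟩ := isolated b
    -- The edges from `v` to `x` and `y` have different colours other than `c`. If `x` and `y` share
    -- a component, a vertex of another one sees both in a single colour, yet by `color` in those
    -- two; otherwise the edge between `x` and `y` itself gets both.
    by_cases hxy : MonoConnected col c M x y
    · obtain ⟨z, hz, hzx⟩ : ∃ z ∈ M, ¬ MonoConnected col c M x z := by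
        by_contra! h
        exact hpq (((h p hp).symm hcol).trans (h q hq))
      have h1 := color x hx hac z hz fun h => hzx (h.symm hcol)
      have h2 := color y hy hbc z hz fun h => hzx (hxy.trans (h.symm hcol))
      have h3 := hxy.col_eq hcol hrain hz hzx
      rw [hcol z x, hcol z y] at h3
      exact hab (by rw [← h1, ← h2, h3])
    · have h1 := color x hx hac y hy fun h => hxy (h.symm hcol)
      have h2 := color y hy hbc x hx hxy
      exact hab (by rw [← h1, ← h2, hcol])

end Gallai

/-! ### Pairs of orders with the same inversions -/

namespace PosPair

variable {n : ℕ}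

/-- The two pairs of orders coincide on `x`, `y`. -/
def Agree (s t : PosPair n) (x y : Fin n) : Prop :=
  (s.1 x < s.1 y ↔ t.1 x < t.1 y) ∧ (s.2 x < s.2 y ↔ t.2 x < t.2 y)

theorem Agree.trans {s t u : PosPair n} {x y : Fin n} (h : Agree s t x y) (h' : Agree t u x y) :
    Agree s u x y :=
  ⟨h.1.trans h'.1, h.2.trans h'.2⟩

theorem Agree.rfl {s : PosPair n} {x y : Fin n} : Agree s s x y := ⟨Iff.rfl, Iff.rfl⟩

/-- The two pairs of orders have the same inversions, ordered in the same way. -/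
def SameInversions (s t : PosPair n) : Prop :=
  ∀ x y, (s.1 x < s.1 y ∧ s.2 y < s.2 x) ↔ (t.1 x < t.1 y ∧ t.2 y < t.2 x)

open Classical in
/-- Colour `0` for inversions, `1` for other pairs where `s` and `t` agree, `2` for the rest. -/
noncomputable def pairColor (s t : PosPair n) (x y : Fin n) : Fin 3 :=
  if s.1 x < s.1 y ↔ s.2 y < s.2 x then 0 else if s.1 x < s.1 y ↔ t.1 x < t.1 y then 1 else 2

theorem val_ne (f : Equiv.Perm (Fin n)) {x y : Fin n} (h : x ≠ y) : (f x : ℕ) ≠ f y :=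
  fun e => h (f.injective (Fin.ext e))

theorem pairColor_eq_zero {s t : PosPair n} {x y : Fin n} :
    pairColor s t x y = 0 ↔ (s.1 x < s.1 y ↔ s.2 y < s.2 x) := by
  unfold pairColor; split_ifs <;> simp_all

theorem pairColor_eq_one {s t : PosPair n} {x y : Fin n} :
    pairColor s t x y = 1 ↔ ¬ (s.1 x < s.1 y ↔ s.2 y < s.2 x) ∧ (s.1 x < s.1 y ↔ t.1 x < t.1 y) := by
  unfold pairColor; split_ifs <;> simp_all

theorem pairColor_eq_two {s t : PosPair n} {x y : Fin n} :
    pairColor s t x y = 2 ↔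
      ¬ (s.1 x < s.1 y ↔ s.2 y < s.2 x) ∧ ¬ (s.1 x < s.1 y ↔ t.1 x < t.1 y) := by
  unfold pairColor; split_ifs <;> simp_all

theorem pairColor_comm (s t : PosPair n) (x y : Fin n) :
    pairColor s t x y = pairColor s t y x := by
  by_cases h : x = y
  · rw [h]
  have h1 := val_ne s.1 h
  have h2 := val_ne s.2 h
  have h3 := val_ne t.1 h
  unfold pairColor
  simp only [Fin.lt_def]
  congr 1
  · rw [eq_iff_iff]; omega
  · congr 1
    rw [eq_iff_iff]; omega

theorem pairColor_cases (s t : PosPair n) (x y : Fin n) :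
    pairColor s t x y = 0 ∨ pairColor s t x y = 1 ∨ pairColor s t x y = 2 := by
  unfold pairColor; split_ifs <;> simp

/-- The six possible positions of two labels in the four orders. -/
theorem pairColor_spec {s t : PosPair n} (hst : SameInversions s t) {x y : Fin n} (hxy : x ≠ y) :
    (pairColor s t x y = 0 →
      (s.1 x < s.1 y ∧ s.2 y < s.2 x ∧ t.1 x < t.1 y ∧ t.2 y < t.2 x) ∨
      (s.1 y < s.1 x ∧ s.2 x < s.2 y ∧ t.1 y < t.1 x ∧ t.2 x < t.2 y)) ∧
    (pairColor s t x y = 1 →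
      (s.1 x < s.1 y ∧ s.2 x < s.2 y ∧ t.1 x < t.1 y ∧ t.2 x < t.2 y) ∨
      (s.1 y < s.1 x ∧ s.2 y < s.2 x ∧ t.1 y < t.1 x ∧ t.2 y < t.2 x)) ∧
    (pairColor s t x y = 2 →
      (s.1 x < s.1 y ∧ s.2 x < s.2 y ∧ t.1 y < t.1 x ∧ t.2 y < t.2 x) ∨
      (s.1 y < s.1 x ∧ s.2 y < s.2 x ∧ t.1 x < t.1 y ∧ t.2 x < t.2 y)) := by
  have h1 := val_ne s.1 hxy
  have h2 := val_ne s.2 hxy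
  have h3 := val_ne t.1 hxy
  have h4 := val_ne t.2 hxy
  have i1 := hst x y
  have i2 := hst y x
  rw [pairColor_eq_zero, pairColor_eq_one, pairColor_eq_two]
  simp only [Fin.lt_def] at *
  refine ⟨?_, ?_, ?_⟩ <;> omega

/-- In a rainbow triangle only the pair of colour `2` changes its order between `s` and `t`, so the
third label is never between its two members. It then compares alike with both in either order of
`s`, so its pairs with them are both inversions or both not. -/
theorem pairColor_not_rainbow {s t : PosPair n} (hst : SameInversions s t) (x y z : Fin n)
    (hxy : x ≠ y) (hyz : y ≠ z) (hxz : x ≠ z) :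
    pairColor s t x y = pairColor s t y z ∨ pairColor s t x y = pairColor s t x z ∨
      pairColor s t y z = pairColor s t x z := by
  obtain ⟨a0, a1, a2⟩ := pairColor_spec hst hxy
  obtain ⟨b0, b1, b2⟩ := pairColor_spec hst hyz
  obtain ⟨c0, c1, c2⟩ := pairColor_spec hst hxz
  simp only [Fin.lt_def] at *
  by_contra! hne
  obtain ⟨n1, n2, n3⟩ := hne
  clear hst hxy hyz hxz
  rcases pairColor_cases s t x y with h | h | h <;>
  rcases pairColor_cases s t y z with h' | h' | h' <;> rw [h, h'] at n1 <;>
  first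
  | exact absurd rfl n1
  | (rcases pairColor_cases s t x z with h'' | h'' | h'' <;> rw [h, h''] at n2 <;> rw [h', h''] at n3 <;>
     first
     | exact absurd rfl n2
     | exact absurd rfl n3
     | (simp only [h, h', h'', forall_true_left, Fin.reduceEq, IsEmpty.forall_iff]
          at a0 a1 a2 b0 b1 b2 c0 c1 c2
        clear n1 n2 n3 h h' h''
        rcases ‹_ ∨ _› with A | A <;> omega))

/-- By the lack of rainbows `x` sees `y` and `z` in one colour. If `x` were between them in one
order, that colour would put it between them in the other three and force itself upon the pair `y`,
`z`. -/
theorem uniform_of_pairColor {s t : PosPair n} (hst : SameInversions s t) {c : Fin 3}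
    {x y z : Fin n} (hyz : y ≠ z) (hxy : x ≠ y) (hxz : x ≠ z) (hc : pairColor s t y z = c)
    (hy : pairColor s t x y ≠ c) (hz : pairColor s t x z ≠ c) :
    (s.1 x < s.1 y ↔ s.1 x < s.1 z) ∧ (s.2 x < s.2 y ↔ s.2 x < s.2 z) ∧
      (t.1 x < t.1 y ↔ t.1 x < t.1 z) ∧ (t.2 x < t.2 y ↔ t.2 x < t.2 z) := by
  obtain ⟨a0, a1, a2⟩ := pairColor_spec hst hxy
  obtain ⟨b0, b1, b2⟩ := pairColor_spec hst hyz
  obtain ⟨c0, c1, c2⟩ := pairColor_spec hst hxz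
  have e := pairColor_not_rainbow hst x y z hxy hyz hxz
  have e' : pairColor s t x y = pairColor s t x z := by
    rw [hc] at e
    exact e.elim (absurd · hy) (·.elim id (absurd ·.symm hz))
  rw [← e'] at c0 c1 c2
  clear e e' hz
  have key : ((s.1 x < s.1 y ∧ s.1 x < s.1 z) ∨ (s.1 y < s.1 x ∧ s.1 z < s.1 x)) ∧
      ((s.2 x < s.2 y ∧ s.2 x < s.2 z) ∨ (s.2 y < s.2 x ∧ s.2 z < s.2 x)) ∧
      ((t.1 x < t.1 y ∧ t.1 x < t.1 z) ∨ (t.1 y < t.1 x ∧ t.1 z < t.1 x)) ∧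
      ((t.2 x < t.2 y ∧ t.2 x < t.2 z) ∨ (t.2 y < t.2 x ∧ t.2 z < t.2 x)) := by
    simp only [Fin.lt_def] at *
    rcases pairColor_cases s t y z with h | h | h <;> rw [h] at hc <;> subst hc <;>
    rcases pairColor_cases s t x y with h' | h' | h' <;>
    first
    | exact absurd h' hy
    | (clear hy
       simp only [h, h', forall_true_left, Fin.reduceEq, IsEmpty.forall_iff] at a0 a1 a2 b0 b1 b2 c0 c1 c2
       refine ⟨?_, ?_, ?_, ?_⟩ <;> omega)
  simp only [Fin.lt_def] at *
  refine ⟨?_, ?_, ?_, ?_⟩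
  · have := key.1; clear * - this; omega
  · have := key.2.1; clear * - this; omega
  · have := key.2.2.1; clear * - this; omega
  · have := key.2.2.2; clear * - this; omega

theorem uniform_of_component {s t : PosPair n} (hst : SameInversions s t) {c : Fin 3}
    {M : Finset (Fin n)} {x y z : Fin n} (hz : z ∈ M)
    (hxy : MonoConnected (pairColor s t) c M x y)
    (hxz : ¬ MonoConnected (pairColor s t) c M x z) :
    (s.1 z < s.1 x ↔ s.1 z < s.1 y) ∧ (s.2 z < s.2 x ↔ s.2 z < s.2 y) ∧
      (t.1 z < t.1 x ↔ t.1 z < t.1 y) ∧ (t.2 z < t.2 x ↔ t.2 z < t.2 y) := by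
  induction hxy with
  | refl => simp
  | @tail y w hy hyw ih =>
    have hyz : z ≠ y := fun e => hxz (e ▸ hy)
    have hwz : z ≠ w := fun e => hxz (e ▸ hy.tail hyw)
    have h1 : pairColor s t z y ≠ c :=
      fun e => hxz (hy.tail ⟨hyw.1, hz, hyz.symm, by rw [pairColor_comm, e]⟩)
    have h2 : pairColor s t z w ≠ c :=
      fun e => hxz ((hy.tail hyw).tail ⟨hyw.2.1, hz, hwz.symm, by rw [pairColor_comm, e]⟩)
    have := uniform_of_pairColor hst hyw.2.2.1 hyz hwz hyw.2.2.2 h1 h2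
    exact ⟨ih.1.trans this.1, ih.2.1.trans this.2.1, ih.2.2.1.trans this.2.2.1,
      ih.2.2.2.trans this.2.2.2⟩

open Classical in
/-- The monochromatic component of `x` inside `M`. -/
noncomputable def component (s t : PosPair n) (c : Fin 3) (M : Finset (Fin n)) (x : Fin n) :
    Finset (Fin n) :=
  M.filter (MonoConnected (pairColor s t) c M x)

theorem mem_component {s t : PosPair n} {c : Fin 3} {M : Finset (Fin n)} {x y : Fin n} :
    y ∈ component s t c M x ↔ y ∈ M ∧ MonoConnected (pairColor s t) c M x y := by
  simp [component]

theorem isBlock_component {s t : PosPair n} (hst : SameInversions s t) (c : Fin 3)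
    {M : Finset (Fin n)} (hM : IsBlock s M) (x : Fin n) : IsBlock s (component s t c M x) := by
  intro z hz y hy w hw
  rw [mem_component] at hz hy hw
  by_cases hzM : z ∈ M
  · have hz' : ¬ MonoConnected (pairColor s t) c M x z := fun h => hz ⟨hzM, h⟩
    have h1 := uniform_of_component hst hzM hy.2 hz'
    have h2 := uniform_of_component hst hzM hw.2 hz'
    exact ⟨h1.1.symm.trans h2.1, h1.2.1.symm.trans h2.2.1⟩
  · exact hM z hzM y hy.1 w hw.1

theorem IsBlock.of_isSwapReverse {s t : PosPair n} {M K : Finset (Fin n)} (hK : IsBlock s K)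
    (hKM : K ⊆ M) (h : IsSwapReverse M s t) : IsBlock t K := by
  intro z hz y hy w hw
  have h1 := hK z hz y hy w hw
  by_cases hzM : z ∈ M
  · have a := (h z y).1 ⟨hzM, hKM hy⟩
    have b := (h z w).1 ⟨hzM, hKM hw⟩
    have hzy : z ≠ y := fun e => hz (e ▸ hy)
    have hzw : z ≠ w := fun e => hz (e ▸ hw)
    have := val_ne s.1 hzy
    have := val_ne s.1 hzw
    have := val_ne s.2 hzy
    have := val_ne s.2 hzw
    rw [a.1, a.2, b.1, b.2]
    simp only [Fin.lt_def] at *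
    omega
  · have a := (h z y).2 fun e => hzM e.1
    have b := (h z w).2 fun e => hzM e.1
    rw [a.1, a.2, b.1, b.2]
    exact h1

/-- Exchange with reversal fixes the inversions inside `M` and turns around the other pairs there.
-/
theorem SameInversions.of_isSwapReverse {s t u : PosPair n} {M : Finset (Fin n)}
    (hsu : SameInversions s u) (h : IsSwapReverse M s t) : SameInversions t u := by
  intro x y
  rw [← hsu x y]
  by_cases hxy : x ∈ M ∧ y ∈ M
  · have a := (h x y).1 hxy
    have b := (h y x).1 hxy.symm
    rw [a.1, b.2]
    tauto
  · have a := (h x y).2 hxy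
    have b := (h y x).2 fun e => hxy e.symm
    rw [a.1, b.2]

/-- From `s` one can reach a pair which coincides with `t` inside `M` and with `s` outside. -/
def CanFix (R : PosPair n → PosPair n → Prop) (s t : PosPair n) (M : Finset (Fin n)) : Prop :=
  ∃ s', R s s' ∧ (∀ x ∈ M, ∀ y ∈ M, Agree s' t x y) ∧ ∀ x y, ¬ (x ∈ M ∧ y ∈ M) → Agree s' s x y

variable {R : PosPair n → PosPair n → Prop}

/-- The classes are repaired one at a time. By `hB` each disagreement lies inside a class, and
repairing a class touches no other pair, so the number of disagreements drops while the remaining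
classes stay blocks. -/
theorem canFix_of_classes (hrefl : ∀ s, R s s) (htrans : ∀ s t u, R s t → R t u → R s u)
    (t : PosPair n) (M : Finset (Fin n)) (K : Fin n → Finset (Fin n)) (hKM : ∀ x ∈ M, K x ⊆ M)
    (hself : ∀ x ∈ M, x ∈ K x) (hK : ∀ x ∈ M, ∀ y ∈ M, ∀ z, z ∈ K x → z ∈ K y → K x = K y)
    (hfix : ∀ x ∈ M, ∀ s, SameInversions s t → IsBlock s (K x) → CanFix R s t (K x))
    (s : PosPair n) (hst : SameInversions s t) (hblock : ∀ x ∈ M, IsBlock s (K x))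
    (hB : ∀ x ∈ M, ∀ y ∈ M, ¬ Agree s t x y → y ∈ K x) : CanFix R s t M := by
  classical
  induction hN : ((M ×ˢ M).filter fun p => ¬ Agree s t p.1 p.2).card using Nat.strong_induction_on
    generalizing s with
  | _ N ih =>
  subst hN
  by_cases hall : ∀ x ∈ M, ∀ y ∈ M, Agree s t x y
  · exact ⟨s, hrefl s, hall, fun _ _ _ => Agree.rfl⟩
  push Not at hall
  obtain ⟨x, hx, y, hy, hxy⟩ := hall
  obtain ⟨s₁, hs₁, hin, hout⟩ := hfix x hx s hst (hblock x hx)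
  have hst₁ : SameInversions s₁ t := by
    intro a b
    by_cases hab : a ∈ K x ∧ b ∈ K x
    · rw [(hin a hab.1 b hab.2).1, (hin b hab.2 a hab.1).2]
    · rw [(hout a b hab).1, (hout b a fun e => hab e.symm).2, hst a b]
  have hmono : ∀ a b, ¬ Agree s₁ t a b → ¬ Agree s t a b := by
    intro a b h h'
    by_cases hab : a ∈ K x ∧ b ∈ K x
    · exact h (hin a hab.1 b hab.2)
    · exact h ((hout a b hab).trans h')
  obtain ⟨s', hs', hin', hout'⟩ := ih _ (by
    refine Finset.card_lt_card ((Finset.ssubset_iff_of_subset ?_).2 ⟨(x, y), ?_, ?_⟩)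
    · intro p hp
      rw [Finset.mem_filter] at hp ⊢
      exact ⟨hp.1, hmono _ _ hp.2⟩
    · simp [hx, hy, hxy]
    · simp [hin x (hself x hx) y (hB x hx y hy hxy)]) s₁ hst₁ (by
    intro a ha z hz p hp q hq
    have hzp : ¬ (z ∈ K x ∧ p ∈ K x) := fun e => hz (hK a ha x hx p hp e.2 ▸ e.1)
    have hzq : ¬ (z ∈ K x ∧ q ∈ K x) := fun e => hz (hK a ha x hx q hq e.2 ▸ e.1)
    have h1 := hout z p hzp
    have h2 := hout z q hzq
    rw [h1.1, h1.2, h2.1, h2.2]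
    exact hblock a ha z hz p hp q hq) (fun a ha b hb h => hB a ha b hb (hmono a b h)) rfl
  refine ⟨s', htrans _ _ _ hs₁ hs', hin', fun a b hab => (hout' a b hab).trans (hout a b ?_)⟩
  exact fun e => hab ⟨hKM x hx e.1, hKM x hx e.2⟩

theorem component_eq {s t : PosPair n} {c : Fin 3} {M : Finset (Fin n)} {x y z : Fin n}
    (hx : z ∈ component s t c M x) (hy : z ∈ component s t c M y) :
    component s t c M x = component s t c M y := by
  have hsymm : ∀ {a b}, MonoConnected (pairColor s t) c M a b →
      MonoConnected (pairColor s t) c M b a := fun h => h.symm (pairColor_comm s t)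
  rw [mem_component] at hx hy
  ext w
  rw [mem_component, mem_component]
  exact ⟨fun h => ⟨h.1, (hy.2.trans (hsymm hx.2)).trans h.2⟩,
    fun h => ⟨h.1, (hx.2.trans (hsymm hy.2)).trans h.2⟩⟩

theorem component_ssubset {s t : PosPair n} {c : Fin 3} {M : Finset (Fin n)} {p q : Fin n}
    (hp : p ∈ M) (hq : q ∈ M) (hpq : ¬ MonoConnected (pairColor s t) c M p q) (x : Fin n) :
    component s t c M x ⊂ M := by
  refine (Finset.ssubset_iff_of_subset fun y hy => (mem_component.1 hy).1).2 ?_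
  by_contra! h
  have hp' := (mem_component.1 (h p hp)).2
  have hq' := (mem_component.1 (h q hq)).2
  exact hpq ((hp'.symm (pairColor_comm s t)).trans hq')

theorem agree_of_pairColor {s t : PosPair n} (hst : SameInversions s t) {x y : Fin n}
    (h : pairColor s t x y ≠ 2) : Agree s t x y := by
  by_cases hxy : x = y
  · subst hxy; simp [Agree]
  obtain ⟨a0, a1, -⟩ := pairColor_spec hst hxy
  unfold Agree
  simp only [Fin.lt_def] at *
  rcases pairColor_cases s t x y with e | e | e
  · have := a0 e; omega
  · have := a1 e; omega
  · exact absurd e h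

/-- Pairs of orders with the same inversions are joined by reversals of the other pairs. -/
theorem canFix (hrefl : ∀ s, R s s) (htrans : ∀ s t u, R s t → R t u → R s u)
    (hR : ∀ s M, IsBlock s M → ∃ t, R s t ∧ IsSwapReverse M s t) (t : PosPair n)
    (M : Finset (Fin n)) :
    ∀ s, SameInversions s t → IsBlock s M → CanFix R s t M := by
  induction M using Finset.strongInduction with
  | _ M ih =>
  intro s hst hM
  by_cases hall : ∀ x ∈ M, ∀ y ∈ M, Agree s t x y
  · exact ⟨s, hrefl s, hall, fun _ _ _ => Agree.rfl⟩
  push Not at hall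
  obtain ⟨x, hx, y, hy, hxy⟩ := hall
  have hcard : 1 < M.card := by
    rw [Finset.one_lt_card]
    exact ⟨x, hx, y, hy, by rintro rfl; simp [Agree] at hxy⟩
  obtain ⟨c, p, hp, q, hq, hpq⟩ := exists_not_monoConnected (pairColor_comm s t)
    (pairColor_not_rainbow hst) (by decide) M hcard
  have hss := component_ssubset hp hq hpq
  -- Colours and components remain those of `s`, whereas `u` may be a pair reached later.
  have hclasses : ∀ u, SameInversions u t → (∀ x ∈ M, IsBlock u (component s t c M x)) →
      (∀ x ∈ M, ∀ y ∈ M, ¬ Agree u t x y → pairColor s t x y = c) → CanFix R u t M := by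
    intro u hut hblock hB
    refine canFix_of_classes hrefl htrans t M (component s t c M) (fun x _ => (hss x).1)
      (fun x hx => mem_component.2 ⟨hx, .refl⟩) (fun x _ y _ z => component_eq)
      (fun x _ => ih _ (hss x)) u hut hblock fun x hx y hy h => mem_component.2 ⟨hy, ?_⟩
    have hne : x ≠ y := by rintro rfl; simp [Agree] at h
    exact .single ⟨hx, hy, hne, hB x hx y hy h⟩
  have hcases : ∀ c : Fin 3, c = 0 ∨ c = 1 ∨ c = 2 := by decide
  rcases hcases c with rfl | rfl | rfl
  -- Colour `0`: pairs across components may agree or disagree with `t`, so one reversal of `M` is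
  -- not enough. The component that `t` puts first is brought to the front and split off.
  · obtain ⟨x₀, hx₀, hmin⟩ := M.exists_min_image t.1 ⟨x, hx⟩
    set K := component s t 0 M x₀
    have hKM : K ⊆ M := (hss x₀).1
    have hx₀K : x₀ ∈ K := mem_component.2 ⟨hx₀, .refl⟩
    have hout : ∀ z ∈ K, ∀ y ∈ M, y ∉ K → pairColor s t y z ≠ 0 ∧ y ≠ z ∧
        ∀ w ∈ K, (s.1 y < s.1 w ↔ s.1 y < s.1 z) ∧ (s.2 y < s.2 w ↔ s.2 y < s.2 z) ∧
          (t.1 y < t.1 w ↔ t.1 y < t.1 z) ∧ (t.2 y < t.2 w ↔ t.2 y < t.2 z) := by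
      intro z hz y hy hyK
      have hz' := (mem_component.1 hz).2
      have hyx₀ : ¬ MonoConnected (pairColor s t) 0 M x₀ y :=
        fun h => hyK (mem_component.2 ⟨hy, h⟩)
      have hyz : y ≠ z := fun e => hyK (e ▸ hz)
      refine ⟨fun e => hyx₀ (hz'.tail ⟨hKM hz, hy, hyz.symm, by rw [pairColor_comm, e]⟩), hyz,
        fun w hw => ?_⟩
      have h1 := uniform_of_component hst hy hz' hyx₀
      have h2 := uniform_of_component hst hy (mem_component.1 hw).2 hyx₀
      exact ⟨h2.1.symm.trans h1.1, h2.2.1.symm.trans h1.2.1, h2.2.2.1.symm.trans h1.2.2.1,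
        h2.2.2.2.symm.trans h1.2.2.2⟩
    have hdir : ∀ z ∈ K, ∀ y ∈ M, y ∉ K →
        (s.1 y < s.1 z ∧ s.2 y < s.2 z ∨ s.1 z < s.1 y ∧ s.2 z < s.2 y) ∧
          t.1 z < t.1 y ∧ t.2 z < t.2 y := by
      intro z hz y hy hyK
      obtain ⟨h1, h2, h3⟩ := hout z hz y hy hyK
      have h4 := h3 x₀ hx₀K
      obtain ⟨-, a1, a2⟩ := pairColor_spec hst h2
      have h5 := hmin y hy
      rw [← not_lt, h4.2.2.1] at h5
      rcases pairColor_cases s t y z with e | e | e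
      · exact absurd e h1
      · have := a1 e
        simp only [Fin.lt_def] at *
        omega
      · have := a2 e
        simp only [Fin.lt_def] at *
        omega
    -- `K` is the last part of `U` in both orders of `s`, and its pairs with the rest of `U` are no
    -- inversions; exchange with reversal on `U` therefore moves it to the front.
    set U := M.filter fun y => ∃ k ∈ K, s.1 y ≤ s.1 k
    have hKU : K ⊆ U := fun k hk => Finset.mem_filter.2 ⟨hKM hk, k, hk, le_rfl⟩
    have hUM : U ⊆ M := Finset.filter_subset _ _
    have hUblock : IsBlock s U := by
      intro z hz y hy w hw
      by_cases hzM : z ∈ M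
      · have hzK : z ∉ K := fun h => hz (hKU h)
        have above : ∀ k ∈ K, s.1 k < s.1 z ∧ s.2 k < s.2 z := by
          intro k hk
          have h1 : ¬ s.1 z ≤ s.1 k := fun h => hz (Finset.mem_filter.2 ⟨hzM, k, hk, h⟩)
          have h2 := (hdir k hk z hzM hzK).1
          simp only [Fin.lt_def, Fin.le_def] at *
          omega
        have above' : ∀ y ∈ U, s.1 y < s.1 z ∧ s.2 y < s.2 z := by
          intro y hy
          by_cases hyK : y ∈ K
          · exact above y hyK
          · obtain ⟨hyM, k, hk, hyk⟩ := Finset.mem_filter.1 hy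
            have h1 := above k hk
            have h2 := (hdir k hk y hyM hyK).1
            simp only [Fin.lt_def, Fin.le_def] at *
            omega
        have h1 := above' y hy
        have h2 := above' w hw
        simp only [Fin.lt_def] at *
        omega
      · exact hM z hzM y (hUM hy) w (hUM hw)
    obtain ⟨u, hu, hflip⟩ := hR s U hUblock
    have hfront : ∀ z ∈ K, ∀ y ∈ M, y ∉ K → u.1 z < u.1 y ∧ u.2 z < u.2 y := by
      intro z hz y hy hyK
      have h1 := (hdir z hz y hy hyK).1
      by_cases hyU : y ∈ U
      · obtain ⟨-, k, hk, hyk⟩ := Finset.mem_filter.1 hyU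
        have h2 := (hflip z y).1 ⟨hKU hz, hyU⟩
        have h3 := (hdir k hk y hy hyK).1
        have h4 := (hout z hz y hy hyK).2.2 k hk
        rw [h2.1, h2.2]
        simp only [Fin.lt_def, Fin.le_def] at *
        omega
      · have h2 := (hflip z y).2 fun e => hyU e.2
        have h3 : ¬ s.1 y ≤ s.1 z := fun h => hyU (Finset.mem_filter.2 ⟨hy, z, hz, h⟩)
        rw [h2.1, h2.2]
        simp only [Fin.lt_def, Fin.le_def] at *
        omega
    have hKblock : IsBlock u K := (isBlock_component hst 0 hM x₀).of_isSwapReverse hKU hflip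
    have hMblock : IsBlock u M := by
      intro z hz y hy w hw
      have h1 := (hflip z y).2 fun e => hz (hUM e.1)
      have h2 := (hflip z w).2 fun e => hz (hUM e.1)
      rw [h1.1, h1.2, h2.1, h2.2]
      exact hM z hz y hy w hw
    have hdiff : IsBlock u (M \ K) := by
      intro z hz y hy w hw
      rw [Finset.mem_sdiff] at hy hw hz
      by_cases hzM : z ∈ M
      · have hzK : z ∈ K := by tauto
        have h1 := hfront z hzK y hy.1 hy.2
        have h2 := hfront z hzK w hw.1 hw.2
        simp [h1, h2]
      · exact hMblock z hzM y hy.1 w hw.1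
    have hdiffss : M \ K ⊂ M := Finset.sdiff_ssubset hKM ⟨x₀, hx₀K⟩
    -- All pairs between `K` and `M \ K` now agree with `t`, so these two proper blocks serve as
    -- classes.
    obtain ⟨s', hs', hin, hout'⟩ := canFix_of_classes hrefl htrans t M
      (fun x => if x ∈ K then K else M \ K) (by intro x _; split_ifs <;> simp [hKM])
      (by intro x hx; split_ifs with h <;> simp [hx, h])
      (by
        intro x _ y _ z hx hy
        split_ifs at hx hy ⊢ <;> simp_all)
      (by
        intro x _
        split_ifs
        · exact ih _ (hss x₀)
        · exact ih _ hdiffss)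
      u (hst.of_isSwapReverse hflip)
      (by
        intro x _
        split_ifs
        · exact hKblock
        · exact hdiff)
      (by
        intro x hx y hy h
        by_contra hne
        apply h
        by_cases hxK : x ∈ K
        · have hyK : y ∉ K := by simpa [hxK] using hne
          have h1 := hfront x hxK y hy hyK
          have h2 := (hdir x hxK y hy hyK).2
          simp [Agree, h1, h2]
        · have hyK : y ∈ K := by simpa [hxK, hy] using hne
          have h1 := hfront y hyK x hx hxK
          have h2 := (hdir y hyK x hx hxK).2
          exact ⟨iff_of_false (lt_asymm h1.1) (lt_asymm h2.1),
            iff_of_false (lt_asymm h1.2) (lt_asymm h2.2)⟩)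
    exact ⟨s', htrans _ _ _ hu hs', hin, fun x y hxy => (hout' x y hxy).trans
      ((hflip x y).2 fun e => hxy ⟨hUM e.1, hUM e.2⟩)⟩
  -- Colour `1`: after turning around all non-inversions in `M`, the disagreements are exactly the
  -- pairs of colour `1`.
  · obtain ⟨u, hu, hflip⟩ := hR s M hM
    obtain ⟨s', hs', hin, hout⟩ := hclasses u (hst.of_isSwapReverse hflip)
      (fun x _ => (isBlock_component hst 1 hM x).of_isSwapReverse (hss x).1 hflip) (by
        intro x hx y hy h
        by_contra hne
        apply h
        by_cases hxy : x = y
        · subst hxy; simp [Agree]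
        have := (hflip x y).1 ⟨hx, hy⟩
        obtain ⟨a0, -, a2⟩ := pairColor_spec hst hxy
        rw [Agree, this.1, this.2]
        simp only [Fin.lt_def] at *
        rcases pairColor_cases s t x y with e | e | e
        · have := a0 e; omega
        · exact absurd e hne
        · have := a2 e; omega)
    exact ⟨s', htrans _ _ _ hu hs', hin,
      fun x y hxy => (hout x y hxy).trans ((hflip x y).2 hxy)⟩
  -- Colour `2`: the disagreements already lie inside the components.
  · refine hclasses s hst (fun x _ => isBlock_component hst 2 hM x) fun x _ y _ h => ?_
    by_contra hne
    exact h (agree_of_pairColor hst hne)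

end PosPair

/-! ### From inversion graphs and triple parities to spindle moves -/

namespace PosPair

variable {n : ℕ} {R : PosPair n → PosPair n → Prop}

theorem perm_eq_of_lt_iff {f g : Equiv.Perm (Fin n)} (h : ∀ x y, f x < f y ↔ g x < g y) :
    f = g := by
  let e : Fin n ≃o Fin n := (f.symm.trans g).toOrderIso
    (fun x y hxy => by
      have := (h (f.symm y) (f.symm x)).not
      simpa using this.1 (by simpa using hxy))
    (fun x y hxy => by
      have := (h (g.symm y) (g.symm x)).not
      simpa using this.2 (by simpa using hxy))
  have he : e = OrderIso.refl _ := Subsingleton.elim _ _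
  ext x
  have : e (f x) = f x := by rw [he]; rfl
  exact congrArg Fin.val (this.symm.trans (show g (f.symm (f x)) = g x by simp))

theorem exists_perm_of_order (r : Fin n → Fin n → Prop) (hirr : ∀ x, ¬ r x x)
    (htr : ∀ x y z, r x y → r y z → r x z) (htot : ∀ x y, x ≠ y → r x y ∨ r y x) :
    ∃ f : Equiv.Perm (Fin n), ∀ x y, f x < f y ↔ r x y := by
  classical
  have hlt : ∀ x y, r x y → (Finset.univ.filter (r · x)).card < (Finset.univ.filter (r · y)).card := by
    intro x y hxy
    refine Finset.card_lt_card ((Finset.ssubset_iff_of_subset fun z hz => ?_).2 ⟨x, ?_, ?_⟩)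
    · simp only [Finset.mem_filter, Finset.mem_univ, true_and] at hz ⊢
      exact htr z x y hz hxy
    · simpa using hxy
    · simpa using hirr x
  have hn : ∀ x, (Finset.univ.filter (r · x)).card < n := by
    intro x
    have := Finset.card_lt_card ((Finset.ssubset_iff_of_subset
      (Finset.subset_univ (Finset.univ.filter (r · x)))).2 ⟨x, Finset.mem_univ x, by simpa using hirr x⟩)
    simpa using this
  have hiff : ∀ x y, (Finset.univ.filter (r · x)).card < (Finset.univ.filter (r · y)).card ↔ r x y := by
    refine fun x y => ⟨fun h => ?_, hlt x y⟩
    by_contra hxy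
    rcases eq_or_ne x y with rfl | hne
    · exact lt_irrefl _ h
    · exact lt_asymm h (hlt y x ((htot x y hne).resolve_left hxy))
  have hinj : Function.Injective fun x : Fin n =>
      (⟨(Finset.univ.filter (r · x)).card, hn x⟩ : Fin n) := by
    intro x y hxy
    by_contra hne
    have hxy' : (Finset.univ.filter (r · x)).card = (Finset.univ.filter (r · y)).card := by
      simpa using hxy
    rcases htot x y hne with h | h
    · exact (hlt x y h).ne hxy'
    · exact (hlt y x h).ne' hxy'
  exact ⟨Equiv.ofBijective _ (Finite.injective_iff_bijective.1 hinj), fun x y => hiff x y⟩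

/-- `R` is abstract because of two uses: as `Reach`, and as `Reach` between flipped pairs. -/
theorem SameInversions.related (hrefl : ∀ s, R s s) (htrans : ∀ s t u, R s t → R t u → R s u)
    (hR : ∀ s M, IsBlock s M → ∃ t, R s t ∧ IsSwapReverse M s t) {s t : PosPair n}
    (hst : SameInversions s t) : R s t := by
  obtain ⟨s', hs', h, -⟩ := canFix hrefl htrans hR t Finset.univ s hst
    (fun x hx => absurd (Finset.mem_univ x) hx)
  have h1 : s'.1 = t.1 := perm_eq_of_lt_iff fun x y => (h x (by simp) y (by simp)).1
  have h2 : s'.2 = t.2 := perm_eq_of_lt_iff fun x y => (h x (by simp) y (by simp)).2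
  rwa [Prod.ext h1 h2] at hs'

/-- Reversing the second order. -/
def flip (s : PosPair n) : PosPair n := (s.1, s.2.trans Fin.revPerm)

@[simp] theorem flip_flip (s : PosPair n) : s.flip.flip = s := by
  refine Prod.ext rfl ?_
  ext x
  simp [flip]

@[simp] theorem flip_fst (s : PosPair n) (x : Fin n) : s.flip.1 x = s.1 x := rfl

@[simp] theorem flip_snd (s : PosPair n) (x : Fin n) : s.flip.2 x = (s.2 x).rev := rfl

/-- Conjugation by the flip turns a plain exchange of the two orders into an exchange with reversal.
-/
theorem exists_reach_flip (s : PosPair n) {M : Finset (Fin n)} (hM : IsBlock s M) :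
    ∃ t, Reach s.flip t.flip ∧ IsSwapReverse M s t := by
  have hM' : IsBlock s.flip M := by
    intro x hx y hy z hz
    have := hM x hx y hy z hz
    have := val_ne s.2 fun e : x = y => hx (e ▸ hy)
    have := val_ne s.2 fun e : x = z => hx (e ▸ hz)
    simp only [flip_fst, flip_snd, Fin.rev_lt_rev]
    simp only [Fin.lt_def] at *
    omega
  obtain ⟨t, ht, hswap⟩ := exists_reach_isSwap s.flip hM'
  refine ⟨t.flip, by simpa using ht, fun x y => ⟨fun hxy => ?_, fun hxy => ?_⟩⟩
  · have h1 := (hswap x y).1 hxy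
    have h2 := (hswap y x).1 hxy.symm
    simp only [flip_fst, flip_snd, Fin.rev_lt_rev] at h1 h2 ⊢
    exact ⟨h1.1, h2.2⟩
  · have h1 := (hswap x y).2 hxy
    have h2 := (hswap y x).2 fun e => hxy e.symm
    simp only [flip_fst, flip_snd, Fin.rev_lt_rev] at h1 h2 ⊢
    exact ⟨h1.1, h2.2⟩

/-- The two orders agree on `x`, `y`. -/
def Concordant (s : PosPair n) (x y : Fin n) : Prop := s.1 x < s.1 y ↔ s.2 x < s.2 y

theorem reach_of_concordant {s t : PosPair n} (h : ∀ x y, Concordant s x y ↔ Concordant t x y) :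
    Reach s t := by
  have spec : ∀ x y, x ≠ y →
      ((s.1 x < s.1 y ∧ s.2 x < s.2 y ∨ s.1 y < s.1 x ∧ s.2 y < s.2 x) ∧
        (t.1 x < t.1 y ∧ t.2 x < t.2 y ∨ t.1 y < t.1 x ∧ t.2 y < t.2 x)) ∨
      ((s.1 x < s.1 y ∧ s.2 y < s.2 x ∨ s.1 y < s.1 x ∧ s.2 x < s.2 y) ∧
        (t.1 x < t.1 y ∧ t.2 y < t.2 x ∨ t.1 y < t.1 x ∧ t.2 x < t.2 y)) := by
    intro x y hxy
    have h1 := val_ne s.1 hxy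
    have h2 := val_ne s.2 hxy
    have h3 := val_ne t.1 hxy
    have h4 := val_ne t.2 hxy
    have := h x y
    unfold Concordant at this
    simp only [Fin.lt_def] at *
    omega
  -- Discordant pairs follow `s`, concordant ones `t`. This is transitive: of the three steps of a
  -- cyclic triangle two have the same kind, and transitivity within that kind would give the third
  -- pair this kind and the opposite direction.
  obtain ⟨α, hα⟩ := exists_perm_of_order
    (fun x y => (s.1 x < s.1 y ∧ s.2 y < s.2 x) ∨ (t.1 x < t.1 y ∧ t.2 x < t.2 y))
    (by simp) (by
      intro x y z hxy hyz
      have hne : x ≠ z := by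
        rintro rfl
        have := spec x y (by rintro rfl; simp at hxy)
        simp only [Fin.lt_def] at *
        omega
      have h1 := spec x z hne
      have h2 := spec x y (by rintro rfl; simp at hxy)
      have h3 := spec y z (by rintro rfl; simp at hyz)
      clear hne spec h
      simp only [Fin.lt_def] at *
      rcases hxy with hxy | hxy <;> rcases hyz with hyz | hyz <;> omega)
    (by
      intro x y hxy
      have := spec x y hxy
      simp only [Fin.lt_def] at *
      omega)
  obtain ⟨β, hβ⟩ := exists_perm_of_order
    (fun x y => (s.1 y < s.1 x ∧ s.2 x < s.2 y) ∨ (t.1 x < t.1 y ∧ t.2 x < t.2 y))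
    (by simp) (by
      intro x y z hxy hyz
      have hne : x ≠ z := by
        rintro rfl
        have := spec x y (by rintro rfl; simp at hxy)
        simp only [Fin.lt_def] at *
        omega
      have h1 := spec x z hne
      have h2 := spec x y (by rintro rfl; simp at hxy)
      have h3 := spec y z (by rintro rfl; simp at hyz)
      clear hne spec h
      simp only [Fin.lt_def] at *
      rcases hxy with hxy | hxy <;> rcases hyz with hyz | hyz <;> omega)
    (by
      intro x y hxy
      have := spec x y hxy
      simp only [Fin.lt_def] at *
      omega)
  have h1 : Reach s (α, β) := SameInversions.related Reach.refl
    (fun _ _ _ => Reach.trans) (fun s M => exists_reach_isSwapReverse s) (by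
      intro x y
      simp only [hα, hβ, Fin.lt_def]
      omega)
  -- The flip makes concordant pairs inversions, and on these `(α, β)` and `t` coincide.
  have h2 : Reach (flip (flip (α, β))) (flip (flip t)) :=
    SameInversions.related (R := fun s t => Reach s.flip t.flip) (fun s => Reach.refl s.flip)
      (fun _ _ _ => Reach.trans) (fun s M => exists_reach_flip s) (by
      intro x y
      simp only [flip_fst, flip_snd, Fin.rev_lt_rev, hα, hβ]
      simp only [Fin.lt_def]
      omega)
  simp only [flip_flip] at h2
  exact h1.trans h2

/-- The parity of the number of inversions in a triple of labels. -/
def TripleEven (s : PosPair n) (x y z : Fin n) : Prop :=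
  Concordant s x y ↔ (Concordant s y z ↔ Concordant s x z)

/-- Arithmetic modulo 2: the changes `u + v`, `v + w`, `u + w` add up to zero. -/
theorem parity_shift {A B C A' B' C' u v w : Prop} (h₁ : (A ↔ A') ↔ (u ↔ v))
    (h₂ : (B ↔ B') ↔ (v ↔ w)) (h₃ : (C ↔ C') ↔ (u ↔ w)) :
    (A ↔ (B ↔ C)) ↔ (A' ↔ (B' ↔ C')) := by
  by_cases u <;> by_cases v <;> by_cases w <;> simp only [*] at h₁ h₂ h₃ ⊢ <;>
    by_cases A' <;> by_cases B' <;> by_cases C' <;> simp_all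

theorem parity_add {A B C A' B' C' D D' : Prop} (h : (A ↔ (B ↔ C)) ↔ D)
    (h' : (A' ↔ (B' ↔ C')) ↔ D') :
    ((A ↔ A') ↔ ((B ↔ B') ↔ (C ↔ C'))) ↔ (D ↔ D') := by
  rw [← h, ← h']
  by_cases A <;> by_cases B <;> by_cases C <;> simp [*] <;> tauto

/-- The parity records the cyclic orientation of three positions. A shift alters a comparison
exactly when one of its two positions wraps around and the other does not. -/
theorem cyclic_iff {f g : Equiv.Perm (Fin n)} {a : Fin n} (h : ∀ x, f x = g x + a)
    {x y z : Fin n} (hxy : x ≠ y) (hyz : y ≠ z) (hxz : x ≠ z) :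
    (f x < f y ↔ (f y < f z ↔ f x < f z)) ↔ (g x < g y ↔ (g y < g z ↔ g x < g z)) := by
  have h1 := val_ne g hxy
  have h2 := val_ne g hyz
  have h3 := val_ne g hxz
  have := val_add_cases (h x)
  have := val_add_cases (h y)
  have := val_add_cases (h z)
  have := (f x).isLt
  have := (f y).isLt
  have := (f z).isLt
  have := (g x).isLt
  have := (g y).isLt
  have := (g z).isLt
  have kxy : (f x < f y ↔ g x < g y) ↔ ((f x : ℕ) = g x + a ↔ (f y : ℕ) = g y + a) := by
    simp only [Fin.lt_def]; omega
  have kyz : (f y < f z ↔ g y < g z) ↔ ((f y : ℕ) = g y + a ↔ (f z : ℕ) = g z + a) := by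
    simp only [Fin.lt_def]; omega
  have kxz : (f x < f z ↔ g x < g z) ↔ ((f x : ℕ) = g x + a ↔ (f z : ℕ) = g z + a) := by
    simp only [Fin.lt_def]; omega
  exact parity_shift kxy kyz kxz

/-- Triple parity combines the cyclic orientations in the two orders, so rotations preserve it; once
`x₀` is first in both, its pairs are concordant and only the pair `y`, `z` contributes. -/
theorem exists_reach_zero [NeZero n] (s : PosPair n) (x₀ : Fin n) :
    ∃ s', Reach s s' ∧ Reach s' s ∧ s'.1 x₀ = 0 ∧ s'.2 x₀ = 0 ∧
      ∀ y z, y ≠ z → x₀ ≠ y → x₀ ≠ z → (TripleEven s x₀ y z ↔ Concordant s' y z) := by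
  obtain ⟨α, hα⟩ : ∃ α : Equiv.Perm (Fin n), ∀ x, s.1 x = α x + s.1 x₀ :=
    ⟨s.1.trans (Equiv.subRight (s.1 x₀)), fun x => by simp⟩
  obtain ⟨β, hβ⟩ : ∃ β : Equiv.Perm (Fin n), ∀ x, s.2 x = β x + s.2 x₀ :=
    ⟨s.2.trans (Equiv.subRight (s.2 x₀)), fun x => by simp⟩
  have hα0 : α x₀ = 0 := by simpa using hα x₀
  have hβ0 : β x₀ = 0 := by simpa using hβ x₀
  refine ⟨(α, β), .rotate (s.1 x₀) (-s.2 x₀) hα fun x => ?_,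
    .rotate (-s.1 x₀) (s.2 x₀) (fun x => ?_) fun x => ?_, hα0, hβ0, fun y z hyz hy hz => ?_⟩
  · rw [hβ x]; simp
  · rw [hα x]; simp
  · rw [hβ x]; simp [add_comm]
  · have h1 := cyclic_iff hα hy hyz hz
    have h2 := cyclic_iff hβ hy hyz hz
    have p : ∀ f : Equiv.Perm (Fin n), f x₀ = 0 → ∀ w, x₀ ≠ w → (f x₀ < f w) := by
      intro f hf w hw
      rw [hf]
      exact Fin.pos_iff_ne_zero.2 fun e => hw (f.injective (hf.trans e.symm))
    have p1 := p α hα0 y hy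
    have p2 := p α hα0 z hz
    have p3 := p β hβ0 y hy
    have p4 := p β hβ0 z hz
    simp only [TripleEven, Concordant]
    simp only [p1, p2, p3, p4, true_iff, iff_true] at h1 h2
    exact parity_add h1 h2

theorem reach_of_tripleEven {s t : PosPair n}
    (h : ∀ x y z, x ≠ y → y ≠ z → x ≠ z → (TripleEven s x y z ↔ TripleEven t x y z)) :
    Reach s t := by
  rcases Nat.eq_zero_or_pos n with rfl | hn
  · rw [Subsingleton.elim s t]
    exact Reach.refl t
  have : NeZero n := ⟨hn.ne'⟩
  obtain ⟨s', hs, -, hs1, hs2, hs3⟩ := exists_reach_zero s 0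
  obtain ⟨t', -, ht, ht1, ht2, ht3⟩ := exists_reach_zero t 0
  refine hs.trans (.trans (reach_of_concordant fun y z => ?_) ht)
  have pos : ∀ f : Equiv.Perm (Fin n), f 0 = 0 → ∀ w, (f 0 < f w ↔ 0 ≠ w) ∧ ¬ f w < f 0 := by
    intro f hf w
    refine ⟨?_, by simp [hf]⟩
    rw [hf, Fin.pos_iff_ne_zero, ne_comm]
    exact not_congr ⟨fun e => f.injective (hf.trans e), fun e => by rw [← e, hf]⟩
  rcases eq_or_ne y z with rfl | hyz
  · simp [Concordant]
  rcases eq_or_ne 0 y with rfl | hy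
  · simp only [Concordant, (pos s'.1 hs1 z).1, (pos s'.2 hs2 z).1, (pos t'.1 ht1 z).1,
      (pos t'.2 ht2 z).1]
  rcases eq_or_ne 0 z with rfl | hz
  · simp only [Concordant, (pos s'.1 hs1 y).2, (pos s'.2 hs2 y).2, (pos t'.1 ht1 y).2,
      (pos t'.2 ht2 y).2]
  rw [← hs3 y z hyz hy hz, ← ht3 y z hyz hy hz]
  exact h 0 y z hy hyz hz

end PosPair

/-! ### Linking numbers of lines, their invariance, and their values in spindles -/

theorem crossingDet_smul_add (p v q w : R3) (c d x y : ℝ) :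
    crossingDet (p + x • v) (c • v) (q + y • w) (d • w) = c * d * crossingDet p v q w := by
  simp only [crossingDet, Matrix.det_fin_three, Matrix.of_apply, Matrix.cons_val, Pi.add_apply,
    Pi.sub_apply, Pi.smul_apply, smul_eq_mul]
  ring

theorem lineThrough_congr {p v q w : R3} (h : lineThrough p v = lineThrough q w) (hw : w ≠ 0) :
    ∃ c x : ℝ, c ≠ 0 ∧ w = c • v ∧ q = p + x • v := by
  have h1 : q ∈ lineThrough p v := h ▸ AffineSubspace.self_mem_mk' q _
  have h2 := congrArg AffineSubspace.direction h
  simp only [lineThrough, AffineSubspace.direction_mk'] at h2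
  have h3 : w ∈ Submodule.span ℝ {v} := h2 ▸ Submodule.mem_span_singleton_self w
  obtain ⟨c, hc⟩ := Submodule.mem_span_singleton.1 h3
  rw [lineThrough, AffineSubspace.mem_mk', Submodule.mem_span_singleton] at h1
  obtain ⟨x, hx⟩ := h1
  refine ⟨c, x, ?_, hc.symm, ?_⟩
  · rintro rfl
    exact hw (by rw [← hc, zero_smul])
  · rw [hx]; simp

/-- The product of the three crossing determinants of a triple of lines. -/
def tripleCrossing {n : ℕ} (p v : Fin n → R3) (i j k : Fin n) : ℝ :=
  crossingDet (p i) (v i) (p j) (v j) * crossingDet (p j) (v j) (p k) (v k) *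
    crossingDet (p i) (v i) (p k) (v k)

/-- Base points and directions for a family of lines. -/
def IsParametrization {n : ℕ} (C : Fin n → AffineSubspace ℝ R3) (p v : Fin n → R3) : Prop :=
  ∀ i, v i ≠ 0 ∧ C i = lineThrough (p i) (v i)

/-- The product of the linking numbers of a triple of lines is positive. -/
def LinkPos {n : ℕ} (C : Fin n → AffineSubspace ℝ R3) (i j k : Fin n) : Prop :=
  ∃ p v, IsParametrization C p v ∧ 0 < tripleCrossing p v i j k

theorem linkPos_iff {n : ℕ} {C : Fin n → AffineSubspace ℝ R3} {p v : Fin n → R3}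
    (h : IsParametrization C p v) (i j k : Fin n) :
    LinkPos C i j k ↔ 0 < tripleCrossing p v i j k := by
  refine ⟨?_, fun hpos => ⟨p, v, h, hpos⟩⟩
  rintro ⟨q, w, h', hpos⟩
  choose c x hc hw hq using fun l => lineThrough_congr ((h' l).2.symm.trans (h l).2) (h l).1
  -- Each direction occurs in two of the three factors, so rescaling contributes a square.
  have : tripleCrossing p v i j k = (c i * c j * c k) ^ 2 * tripleCrossing q w i j k := by
    simp only [tripleCrossing, hw, hq, crossingDet_smul_add]
    ring
  rw [this]
  exact mul_pos (by have := hc i; have := hc j; have := hc k; positivity) hpos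

theorem IsSkewConfiguration.exists_parametrization {n : ℕ} {C : Fin n → AffineSubspace ℝ R3}
    (hC : IsSkewConfiguration C) : ∃ p v, IsParametrization C p v := by
  choose p v h using hC.isLine
  exact ⟨p, v, h⟩

/-- A zero determinant is a linear relation between the rows. If `p j - p i` has coefficient zero
the lines are parallel; otherwise solving for it produces a common point. -/
theorem IsSkewConfiguration.crossingDet_ne_zero {n : ℕ} {C : Fin n → AffineSubspace ℝ R3}
    (hC : IsSkewConfiguration C) {p v : Fin n → R3} (h : IsParametrization C p v) {i j : Fin n}
    (hij : i ≠ j) : crossingDet (p i) (v i) (p j) (v j) ≠ 0 := by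
  intro hdet
  obtain ⟨x, hx, hx0⟩ := Matrix.exists_vecMul_eq_zero_iff.2 hdet
  have hrel : x 0 • v i + x 1 • (p j - p i) + x 2 • v j = 0 := by
    ext l
    have := congrFun hx0 l
    simpa [Matrix.vecMul, dotProduct, Fin.sum_univ_three] using this
  by_cases h1 : x 1 = 0
  · rw [h1, zero_smul, add_zero] at hrel
    have h0 : x 0 ≠ 0 := by
      intro h0
      rw [h0, zero_smul, zero_add, smul_eq_zero] at hrel
      have h2 := hrel.resolve_right (h j).1
      exact hx (funext fun l => by fin_cases l <;> simp [h0, h1, h2])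
    have h2 : x 2 ≠ 0 := by
      intro h2
      rw [h2, zero_smul, add_zero, smul_eq_zero] at hrel
      exact h0 (hrel.resolve_right (h i).1)
    refine hC.not_parallel i j hij ?_
    rw [AffineSubspace.parallel_iff_direction_eq_and_eq_bot_iff_eq_bot, (h i).2, (h j).2]
    refine ⟨?_, iff_of_false ?_ ?_⟩
    · simp only [lineThrough, AffineSubspace.direction_mk']
      have : v j = (-(x 0 / x 2)) • v i := by
        have e : x 2 • v j = -(x 0 • v i) := by rw [eq_neg_iff_add_eq_zero, add_comm]; exact hrel
        rw [neg_smul, div_eq_inv_mul, mul_smul, ← smul_neg, ← e, smul_smul, inv_mul_cancel₀ h2,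
          one_smul]
      rw [this, Submodule.span_singleton_smul_eq]
      exact (neg_ne_zero.2 (div_ne_zero h0 h2)).isUnit
    · exact (AffineSubspace.nonempty_iff_ne_bot _).1 (AffineSubspace.mk'_nonempty _ _)
    · exact (AffineSubspace.nonempty_iff_ne_bot _).1 (AffineSubspace.mk'_nonempty _ _)
  · have hmem : p i + (-(x 0 / x 1)) • v i = p j + (x 2 / x 1) • v j := by
      have e : x 1 • (p i + (-(x 0 / x 1)) • v i) = x 1 • (p j + (x 2 / x 1) • v j) := by
        simp only [smul_add, smul_smul, mul_neg, mul_div_cancel₀ _ h1]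
        rw [← sub_eq_zero, ← neg_eq_zero, ← hrel]
        module
      exact smul_right_injective _ h1 e
    have hline : ∀ l (r : ℝ), p l + r • v l ∈ C l := by
      intro l r
      rw [(h l).2, lineThrough, AffineSubspace.mem_mk', Submodule.mem_span_singleton]
      exact ⟨r, by simp⟩
    exact Set.disjoint_left.1 (hC.disjoint i j hij) (hline i _) (hmem ▸ hline j _)

theorem IsSkewConfiguration.tripleCrossing_ne_zero {n : ℕ} {C : Fin n → AffineSubspace ℝ R3}
    (hC : IsSkewConfiguration C) {p v : Fin n → R3} (h : IsParametrization C p v) {i j k : Fin n}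
    (hij : i ≠ j) (hjk : j ≠ k) (hik : i ≠ k) : tripleCrossing p v i j k ≠ 0 :=
  mul_ne_zero (mul_ne_zero (hC.crossingDet_ne_zero h hij) (hC.crossingDet_ne_zero h hjk))
    (hC.crossingDet_ne_zero h hik)

/-- Intermediate value theorem: a continuous function on `[0,1]` without zeros keeps its sign. -/
theorem SkewIsotopy.linkPos {n : ℕ} (κ : SkewIsotopy n) {i j k : Fin n}
    (hij : i ≠ j) (hjk : j ≠ k) (hik : i ≠ k) (a b : unitInterval) :
    LinkPos (κ.lines a) i j k → LinkPos (κ.lines b) i j k := by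
  choose p v hp hv h using κ.continuous
  have hpar : ∀ t, IsParametrization (κ.lines t) (fun l => p l t) (fun l => v l t) :=
    fun t l => h l t
  have hcont : Continuous fun t => tripleCrossing (fun l => p l t) (fun l => v l t) i j k := by
    have hd : ∀ i j, Continuous fun t => crossingDet (p i t) (v i t) (p j t) (v j t) := by
      intro i j
      have hp' := fun l m => (continuous_apply m).comp (hp l)
      have hv' := fun l m => (continuous_apply m).comp (hv l)
      simp only [Function.comp_def] at hp' hv'
      simp only [crossingDet, Matrix.det_fin_three, Matrix.of_apply, Matrix.cons_val,
        Pi.sub_apply]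
      fun_prop
    exact ((hd i j).mul (hd j k)).mul (hd i k)
  have hne : ∀ t, tripleCrossing (fun l => p l t) (fun l => v l t) i j k ≠ 0 :=
    fun t => (κ.skew t).tripleCrossing_ne_zero (hpar t) hij hjk hik
  rw [_root_.linkPos_iff (hpar a), _root_.linkPos_iff (hpar b)]
  intro ha
  by_contra hb
  obtain ⟨t, ht⟩ := mem_range_of_exists_le_of_exists_ge hcont ⟨b, not_lt.1 hb⟩ ⟨a, ha.le⟩
  exact hne t ht

theorem linkPos_comp {n : ℕ} {C : Fin n → AffineSubspace ℝ R3} (hC : IsSkewConfiguration C)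
    (π : Equiv.Perm (Fin n)) (i j k : Fin n) :
    LinkPos (fun l => C (π l)) i j k ↔ LinkPos C (π i) (π j) (π k) := by
  obtain ⟨p, v, h⟩ := hC.exists_parametrization
  have h' : IsParametrization (fun l => C (π l)) (fun l => p (π l)) (fun l => v (π l)) :=
    fun l => h (π l)
  rw [linkPos_iff h', linkPos_iff h]
  rfl

/-- With base point `a + s i • u` and direction `b - a + τ i • v` modulo `u`, the middle row of the
determinant is `(s j - s i) • u`, so multiples of `u` drop out elsewhere. Here `D` is minus the
crossing determinant of axis and directrix, positive since that crossing is negative. -/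
theorem IsSpindle.exists_parametrization {n : ℕ} {σ : Equiv.Perm (Fin n)}
    {C : Fin n → AffineSubspace ℝ R3} (hC : IsSpindle σ C) :
    ∃ (p v : Fin n → R3) (s τ : Fin n → ℝ) (D : ℝ), 0 < D ∧ IsParametrization C p v ∧
      (∀ i j, s i < s j ↔ i < j) ∧ (∀ i j, τ i < τ j ↔ σ i < σ j) ∧
      ∀ i j, crossingDet (p i) (v i) (p j) (v j) = (s j - s i) * (τ j - τ i) * D := by
  obtain ⟨hskew, a, u, b, v, s, τ, hdet, hs, hτ, hs', hτ'⟩ := hC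
  have key : ∀ i, ∃ x : ℝ, (b - a + τ i • v + x • u) ≠ 0 ∧
      C i = lineThrough (a + s i • u) (b - a + τ i • v + x • u) := by
    intro i
    obtain ⟨p, w, hw, hCi⟩ := hskew.isLine i
    have h1 := hs i
    rw [hCi, lineThrough, AffineSubspace.mem_mk'] at h1
    have hq : C i = lineThrough (a + s i • u) w := by
      rw [hCi, lineThrough, lineThrough]
      exact (AffineSubspace.mk'_eq (by
        rw [AffineSubspace.mem_mk']; exact h1)).symm.trans (by simp)
    have hA : a + s i • u ∈ lineThrough a u := by
      rw [lineThrough, AffineSubspace.mem_mk', Submodule.mem_span_singleton]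
      exact ⟨s i, by simp⟩
    have h2 := AffineSubspace.vsub_mem_direction (hτ i)
      ((le_sup_left : C i ≤ C i ⊔ lineThrough a u) (hs i))
    rw [AffineSubspace.direction_sup (hs i) hA, vsub_self, Submodule.span_zero_singleton, sup_bot_eq,
      hq, lineThrough, lineThrough, AffineSubspace.direction_mk', AffineSubspace.direction_mk',
      Submodule.mem_sup] at h2
    obtain ⟨y, hy, z, hz, hyz⟩ := h2
    obtain ⟨c, rfl⟩ := Submodule.mem_span_singleton.1 hy
    obtain ⟨d, rfl⟩ := Submodule.mem_span_singleton.1 hz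
    have e : b - a + τ i • v + (s i * (-1) - d) • u = c • w := by
      rw [vsub_eq_sub] at hyz
      rw [eq_sub_of_add_eq hyz]
      module
    -- Otherwise `b - a` would lie in the span of `u` and `v`, and axis and directrix would not
    -- cross negatively.
    have hc : c ≠ 0 := by
      rintro rfl
      rw [zero_smul] at e
      have hba : b - a = (s i + d) • u - τ i • v := by
        rw [← sub_eq_zero, ← e]; module
      refine hdet.ne ?_
      rw [crossingDet, hba]
      simp only [Matrix.det_fin_three, Matrix.of_apply, Matrix.cons_val,
        Pi.sub_apply, Pi.smul_apply, smul_eq_mul]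
      ring
    refine ⟨_, e ▸ smul_ne_zero hc hw, ?_⟩
    rw [e, hq, lineThrough, lineThrough, Submodule.span_singleton_smul_eq hc.isUnit]
  choose x hx hCx using key
  refine ⟨_, _, s, τ, -crossingDet a u b v, by linarith, fun i => ⟨hx i, hCx i⟩, hs', hτ', ?_⟩
  intro i j
  simp only [crossingDet, Matrix.det_fin_three, Matrix.of_apply, Matrix.cons_val, Pi.add_apply,
    Pi.sub_apply, Pi.smul_apply, smul_eq_mul]
  ring

theorem mul_mul_pos_iff {x y z : ℝ} (hx : x ≠ 0) (hy : y ≠ 0) (hz : z ≠ 0) :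
    0 < x * y * z ↔ (0 < x ↔ (0 < y ↔ 0 < z)) := by
  rcases hx.lt_or_gt with hx | hx <;> rcases hy.lt_or_gt with hy | hy <;>
    rcases hz.lt_or_gt with hz | hz <;>
    simp [mul_pos_iff, mul_neg_iff, hx, hy, hz, hx.not_gt, hy.not_gt, hz.not_gt]

theorem IsSpindle.linkPos_iff {n : ℕ} {σ : Equiv.Perm (Fin n)}
    {C : Fin n → AffineSubspace ℝ R3} (hC : IsSpindle σ C) {i j k : Fin n}
    (hij : i ≠ j) (hjk : j ≠ k) (hik : i ≠ k) :
    LinkPos C i j k ↔ PosPair.TripleEven (Equiv.refl (Fin n), σ) i j k := by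
  obtain ⟨p, v, s, τ, D, hD, h, hs, hτ, hdet⟩ := hC.exists_parametrization
  have hsign : ∀ i j, i ≠ j → (0 < crossingDet (p i) (v i) (p j) (v j) ↔
      PosPair.Concordant (Equiv.refl (Fin n), σ) i j) := by
    intro i j hij
    rw [hdet, mul_pos_iff_of_pos_right hD, mul_pos_iff, sub_pos, sub_pos, sub_neg, sub_neg,
      hs, hs, hτ, hτ]
    have := PosPair.val_ne σ hij
    simp only [PosPair.Concordant, Equiv.refl_apply, Fin.lt_def]
    omega
  rw [_root_.linkPos_iff h, tripleCrossing, mul_mul_pos_iff (hC.1.crossingDet_ne_zero h hij)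
    (hC.1.crossingDet_ne_zero h hjk) (hC.1.crossingDet_ne_zero h hik), hsign i j hij,
    hsign j k hjk, hsign i k hik, PosPair.TripleEven]

theorem IsSpindleConfiguration.linkPos_iff {n : ℕ} {σ : Equiv.Perm (Fin n)}
    {C : Fin n → AffineSubspace ℝ R3} (hC : IsSpindleConfiguration σ C) {i j k : Fin n}
    (hij : i ≠ j) (hjk : j ≠ k) (hik : i ≠ k) :
    LinkPos C i j k ↔ PosPair.TripleEven (Equiv.refl (Fin n), σ) i j k := by
  obtain ⟨κ, h0, rfl⟩ := hC
  rw [← h0.linkPos_iff hij hjk hik]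
  exact ⟨κ.linkPos hij hjk hik 1 0, κ.linkPos hij hjk hik 0 1⟩

theorem mainTheorem3 (n : ℕ) (σ σ' : Equiv.Perm (Fin n))
    (C C' : Fin n → AffineSubspace ℝ R3)
    (hC : IsSpindleConfiguration σ C) (hC' : IsSpindleConfiguration σ' C')
    (ι : SkewIsotopy n) (π : Equiv.Perm (Fin n))
    (hstart : ∀ i, ι.lines 0 i = C i)
    (hend : ∀ i, ι.lines 1 i = C' (π i)) :
    SpindleMoves σ σ' π := by
  have h0 : ι.lines 0 = C := funext hstart
  have h1 : ι.lines 1 = fun i => C' (π i) := funext hend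
  have hskew : IsSkewConfiguration C' := by
    obtain ⟨κ, -, rfl⟩ := hC'
    exact κ.skew 1
  -- The labels are the lines of `σ`: line `i` is at `(i, σ i)` in the first spindle and at `(π i,
  -- σ' (π i))` in the second.
  have h : PosPair.Reach (Equiv.refl (Fin n), σ) (π, π.trans σ') := by
    refine PosPair.reach_of_tripleEven fun i j k hij hjk hik => ?_
    rw [← hC.linkPos_iff hij hjk hik, ← h0]
    have h2 : LinkPos (ι.lines 0) i j k ↔ LinkPos (ι.lines 1) i j k :=
      ⟨ι.linkPos hij hjk hik 0 1, ι.linkPos hij hjk hik 1 0⟩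
    rw [h2, h1, linkPos_comp hskew, hC'.linkPos_iff (π.injective.ne hij) (π.injective.ne hjk)
      (π.injective.ne hik)]
    rfl
  simpa [PosPair.Reach, ← Equiv.trans_assoc] using h
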